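/- **Setting.** Let $N,d\ge1$ be integers, $T>0$, $\mathcal X=\{1,\dots,d\}$, let $\Sigma$ be the set of vectors $\mu=(n^\mu_1,\dots,n^\mu_d)/N$ with $n^\mu_x\in\{0,1,2,\dots\}$ and $\sum_x n^\mu_x=N$, and $\mathscr X=\mathcal X\times\Sigma$. Let $\lambda^0,\lambda^1:\mathscr X\to\mathbb R_+^{d-1}$, $\ell:\mathscr X\times\mathbb R_+^{d-1}\to\mathbb R_+$, $g:\mathscr X\to\mathbb R_+$, where $\ell$ is continuous and, for some $\gamma>0$, $$\tau\ell(x,\mu,a')+(1-\tau)\ell(x,\mu,a)-\ell(x,\mu,\tau a'+(1-\tau)a)\ge\gamma\tau(1-\tau)|a'-a|_2^2$$ for all $(x,\mu)\in\mathscr X$, $a,a'\in\mathbb R_+^{d-1}$, $\tau\in[0,1]$. At position $x$ the coordinates of a vector in $\mathbb R^{d-1}$ are indexed, in increasing order, by the states $y\ne x$. Let $\mathscr A$ be the set of Lipschitz functions $[0,T]\times\mathscr X\to\mathbb R_+^{d-1}$. For $\alpha,\beta\in\mathscr A$ let $\Xi=(X,\mu)$ be the time-inhomogeneous Markov chain on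 $\mathscr X$ with the jump rates, at time $t$, $$(x,\mu)\to(y,\mu):\ \lambda^0_y(x,\mu)+\lambda^1_y(x,\mu)\,\alpha_y(t,x,\mu)\quad(y\ne x),$$ $$(x,\mu)\to(x,\mu+e_{y,z}):\ n^\mu_z\bigl[\lambda^0_y(z,\mu+e_{x,z})+\lambda^1_y(z,\mu+e_{x,z})\,\beta_y(t,z,\mu+e_{x,z})\bigr]\quad(y\ne z),$$ where $e_{x,z}=\frac1N(e_x-e_z)$ and $e_x$ is the $x$-th unit vector. Put $$J(t,x,\mu,\alpha;\beta)=\mathbb E^{\alpha\otimes\beta}\Bigl[\int_t^T\ell(\Xi_u,\alpha(u,\Xi_u))\,du+g(\Xi_T)\,\Big|\,\Xi_t=(x,\mu)\Bigr],\qquad v^\beta=\inf_{\alpha\in\mathscr A}J(\cdot,\alpha;\beta),$$ and let $\alpha^*(\beta)(t,x,\mu)$ be the minimizer over $a\in\mathbb R_+^{d-1}$ of $$\ell(x,\mu,a)+\sum_{y\ne x}a_y\,\lambda^1_y(x,\mu)\,[v^\beta(t,y,\mu)-v^\beta(t,x,\mu)].$$ A control $\alpha\in\mathscr A$ is a *Markov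 perfect equilibrium* (MPE) if $\alpha=\alpha^*(\alpha)$. For $\varepsilon>0$, a control $\gamma^*\in\mathscr A$ is an *$\varepsilon$-MPE* if $J(t,x,\mu,\gamma^*;\gamma^*)\le J(t,x,\mu,\gamma;\gamma^*)+\varepsilon$ for all $(t,x,\mu)\in[0,T]\times\mathscr X$ and $\gamma\in\mathscr A$. Let $\|\psi\|_{\mathcal S}=\max_{t\in[0,T]}\bigl(\sum_{(x,\mu)\in\mathscr X}|\psi(t,x,\mu)|_2^2\bigr)^{1/2}$. For $\rho\in[0,1)$, $\beta^{(0)}=\hat\beta^{(0)}\in\mathscr A$ and Lipschitz errors $\varepsilon^{(n)}:[0,T]\times\mathscr X\to\mathbb R_+^{d-1}$, $n\ge1$, with $\varepsilon_*:=\sup_{n\ge1}\|\varepsilon^{(n)}\|_{\mathcal S}<\infty$, define for $n\ge1$ $$\beta^{(n)}=\rho\beta^{(n-1)}+(1-\rho)\,\alpha^*(\beta^{(n-1)}),\qquad \hat\beta^{(n)}=\rho\hat\beta^{(n-1)}+(1-\rho)\bigl(\alpha^*(\hat\beta^{(n-1)})+\varepsilon^{(n)}\bigr),$$ $v^{(n)}=v^{\beta^{(n-1)}}$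 and $\hat v^{(n)}=v^{\hat\beta^{(n-1)}}$. **Proposition 5.4.** There is a constant $\kappa_*>0$, depending only on the data $(N,d,T,\lambda^0,\lambda^1,\ell,g)$, and for every $\rho\in[0,1)$ and $R\in\mathbb R$ there is a constant $\tilde c>0$, depending only on the data, $\rho$ and $R$, such that the following hold. 1. If $\ell(x,\mu,\cdot)$ is Lipschitz on bounded subsets of $\mathbb R_+^{d-1}$ for every $(x,\mu)$, then, with $\alpha^*$ the MPE, every $\gamma^*\in\mathscr A$ with $\|\gamma^*-\alpha^*\|_{\mathcal S}+\|v^{\gamma^*}-v^{\alpha^*}\|_{\mathcal S}\le\delta$ for some $\delta\in(0,1]$ is a $\kappa_*\delta$-MPE. 2. For every $\beta^{(0)}\in\mathscr A$ with $\|\beta^{(0)}\|_{\mathcal S}\le R$, all errors as above and every $n\ge1$, $$\|\hat\beta^{(n)}-\beta^{(n)}\|_{\mathcal S}^2+\|\hat v^{(n)}-v^{(n)}\|_{\mathcal S}^2\le\tilde c\,\varepsilon_*^2.$$ 3. For every $\beta^{(0)}\in\mathscr A$ with $\|\beta^{(0)}\|_{\mathcal S}\le R$ and every number $e$ with $0<e\le1/(\tilde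 c+1)$ there is $n_*\ge1$ such that, for all errors as above with $\varepsilon_*=e$, every corrupted iterate $\hat\beta^{(n)}$ with $n\ge n_*$ is a $\kappa_*(\tilde c+1)\varepsilon_*$-Markov perfect equilibrium. -/

import Mathlib

open Set

noncomputable section

namespace SymGame

/-- The discretized simplex: `n` is the vector of occupation numbers of the `N` other players over
the `d = m + 1` states; it encodes the empirical distribution `μ = n / N`. -/
abbrev Occ (N m : ℕ) : Type := {n : Fin (m + 1) → ℕ // ∑ x, n x = N}

instance (N m : ℕ) : Fintype (Occ N m) :=
  Fintype.subtype (Finset.piAntidiag Finset.univ N) (by simp)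

/-- The states `(x, μ)`: position of the tagged player, distribution of the other players. -/
abbrev State (N m : ℕ) : Type := Fin (m + 1) × Occ N m

/-- The ambient space of the actions, `ℝ^(d-1)` with its Euclidean norm. In position `x`, the
coordinate `i` of an action is the rate towards the state `x.succAbove i` (which is `i` for states
below `x` and skips `x` afterwards), so that `i ↦ x.succAbove i` enumerates the states `y ≠ x`. -/
abbrev Act (m : ℕ) : Type := EuclideanSpace ℝ (Fin m)

/-- The actions: the closed orthant of `ℝ^(d-1)`. -/
def orthant (m : ℕ) : Set (Act m) := {a | ∀ i, 0 ≤ a i}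

/-- `move n y z` is `μ + e_{y,z}`: one player is moved from `z` to `y`. If there is no player in
`z`, then `n` is left unchanged (this case always carries the weight zero below). -/
def move {N m : ℕ} (n : Occ N m) (y z : Fin (m + 1)) : Occ N m :=
  if h : 0 < n.1 z then
    ⟨fun w => n.1 w - (if w = z then 1 else 0) + (if w = y then 1 else 0), by
      have h1 : ∑ w, ((n.1 w - if w = z then 1 else 0) + if w = z then 1 else 0) = N := by
        refine (Finset.sum_congr rfl fun w _ => ?_).trans n.2
        by_cases hw : w = z
        · subst hw; simp; omega
        · simp [hw]
      rw [Finset.sum_add_distrib] at h1 ⊢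
      simpa using h1⟩
  else n

/-- The data of the symmetric game with `N + 1` players, `d = m + 1` states and horizon `T`, with
the standing assumptions. Costs are only relevant on the orthant of actions. -/
structure Game (N m : ℕ) where
  /-- time horizon -/
  T : ℝ
  /-- uncontrolled rates -/
  rate0 : State N m → Fin m → ℝ
  /-- multipliers of the controlled rates -/
  rate1 : State N m → Fin m → ℝ
  /-- running cost `ℓ` -/
  cost : State N m → Act m → ℝ
  /-- terminal cost `g` -/
  terminal : State N m → ℝ
  T_pos : 0 < T
  rate0_nonneg : ∀ ξ i, 0 ≤ rate0 ξ i
  rate1_nonneg : ∀ ξ i, 0 ≤ rate1 ξ i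
  cost_nonneg : ∀ ξ, ∀ a ∈ orthant m, 0 ≤ cost ξ a
  terminal_nonneg : ∀ ξ, 0 ≤ terminal ξ
  cost_continuous : ∀ ξ, ContinuousOn (cost ξ) (orthant m)
  cost_strongly_convex : ∃ γ : ℝ, 0 < γ ∧
    ∀ ξ, ∀ a ∈ orthant m, ∀ a' ∈ orthant m, ∀ τ ∈ Icc (0 : ℝ) 1,
      γ * τ * (1 - τ) * ‖a' - a‖ ^ 2 ≤
        τ * cost ξ a' + (1 - τ) * cost ξ a - cost ξ (τ • a' + (1 - τ) • a)

/-- Functions of `(t, ξ)` with values in `ℝ^(d-1)`. Only the times in `[0, T]` ever matter. -/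
abbrev Control (N m : ℕ) : Type := ℝ → State N m → Act m

namespace Game

variable {N m : ℕ} (G : Game N m)

/-- Generator of the tagged player's motion, for the instantaneous control `a`. -/
def genOwn (a : State N m → Act m) (φ : State N m → ℝ) (ξ : State N m) : ℝ :=
  ∑ i, (G.rate0 ξ i + G.rate1 ξ i * a ξ i) * (φ (ξ.1.succAbove i, ξ.2) - φ ξ)

/-- Generator of the other players' motion, for their common instantaneous control `b`. A player in
`z` sees the distribution `μ + e_{x,z}`. -/
def genOthers (b : State N m → Act m) (φ : State N m → ℝ) (ξ : State N m) : ℝ :=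
  ∑ z, ∑ i, (ξ.2.1 z : ℝ) *
    (G.rate0 (z, move ξ.2 ξ.1 z) i + G.rate1 (z, move ξ.2 ξ.1 z) i * b (z, move ξ.2 ξ.1 z) i) *
      (φ (ξ.1, move ξ.2 (z.succAbove i) z) - φ ξ)

/-- The admissible controls: Lipschitz on `[0, T] × 𝒳`, with values in the orthant. Since the state
space is finite and discrete, this is Lipschitz continuity in time with a common constant. -/
def Admissible (α : Control N m) : Prop :=
  (∃ K : NNReal, ∀ ξ, LipschitzOnWith K (fun t => α t ξ) (Icc 0 G.T)) ∧
    ∀ t ∈ Icc 0 G.T, ∀ ξ, α t ξ ∈ orthant m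

/-- `p u η` is the probability that `Ξ_u = η` given `Ξ_t = ξ`, for the time-inhomogeneous Markov
chain `Ξ` with generator `genOwn (α u) + genOthers (β u)`, at all times `u ∈ [t, T]`: the
probability vectors `p u` start from the point mass at `ξ` and solve the Kolmogorov forward
equation, tested against all functions `φ`. -/
def IsTransition (α β : Control N m) (t : ℝ) (ξ : State N m) (p : ℝ → State N m → ℝ) : Prop :=
  (∀ η, p t η = if η = ξ then 1 else 0) ∧
    ∀ u ∈ Icc t G.T, p u ∈ stdSimplex ℝ (State N m) ∧
      ∀ φ : State N m → ℝ, HasDerivWithinAt (fun s => ∑ η, p s η * φ η)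
        (∑ η, p u η * (G.genOwn (α u) φ η + G.genOthers (β u) φ η)) (Icc t G.T) u

/-- The transition probabilities of the controlled chain (the solution of the forward equation,
which is unique on `[t, T]`). -/
def transition (α β : Control N m) (t : ℝ) (ξ : State N m) : ℝ → State N m → ℝ :=
  Classical.epsilon (G.IsTransition α β t ξ)

/-- The cost functional
`J(t, ξ, α; β) = E[∫_t^T ℓ(Ξ_u, α(u, Ξ_u)) du + g(Ξ_T) | Ξ_t = ξ]`,
the expectation being computed with the transition probabilities of the controlled chain. -/
def J (t : ℝ) (ξ : State N m) (α β : Control N m) : ℝ :=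
  (∫ u in t..G.T, ∑ η, G.transition α β t ξ u η * G.cost η (α u η)) +
    ∑ η, G.transition α β t ξ G.T η * G.terminal η

/-- The value function `v^β` of the tagged player when all other players use `β`. -/
def value (β : Control N m) (t : ℝ) (ξ : State N m) : ℝ :=
  sInf {c | ∃ α, G.Admissible α ∧ c = G.J t ξ α β}

/-- The first differences `Δ_x φ(·, μ)` at `ξ = (x, μ)`. -/
def diff (φ : State N m → ℝ) (ξ : State N m) (i : Fin m) : ℝ :=
  φ (ξ.1.succAbove i, ξ.2) - φ ξ

/-- The (unique) minimizer of `a ↦ ℓ(ξ, a) + ∑ a_y λ¹_y(ξ) p_y` over the orthant. -/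
def argmin (ξ : State N m) (p : Fin m → ℝ) : Act m :=
  Classical.epsilon fun a => a ∈ orthant m ∧
    IsMinOn (fun b : Act m => G.cost ξ b + ∑ i, b i * G.rate1 ξ i * p i) (orthant m) a

/-- The best response `α*(β)` of the tagged player. -/
def bestResponse (β : Control N m) : Control N m :=
  fun t ξ => G.argmin ξ (diff (G.value β t) ξ)

/-- Symmetric Markov perfect equilibria: the admissible fixed points of the best response. -/
def IsMPE (α : Control N m) : Prop :=
  G.Admissible α ∧ ∀ t ∈ Icc 0 G.T, ∀ ξ, α t ξ = G.bestResponse α t ξ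

/-- `ε`-Markov perfect equilibria. -/
def IsApproxMPE (ε : ℝ) (γ : Control N m) : Prop :=
  G.Admissible γ ∧ ∀ t ∈ Icc 0 G.T, ∀ ξ, ∀ γ', G.Admissible γ' →
    G.J t ξ γ γ ≤ G.J t ξ γ' γ + ε

/-- The norm `max_{t ∈ [0, T]} (∑_ξ |ψ(t, ξ)|²)^(1/2)`. -/
def sNorm {E : Type*} [NormedAddCommGroup E] (ψ : ℝ → State N m → E) : ℝ :=
  ⨆ t : Icc 0 G.T, √(∑ ξ, ‖ψ t ξ‖ ^ 2)

/-- The (weighted) Picard iterates `β^(n)`, with weight `ρ` on the previous iterate. -/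
def picard (ρ : ℝ) (β₀ : Control N m) : ℕ → Control N m
  | 0 => β₀
  | n + 1 => fun t ξ =>
      ρ • picard ρ β₀ n t ξ + (1 - ρ) • G.bestResponse (picard ρ β₀ n) t ξ

/-- The corrupted iterates, where `ε n` is the error of the best response in step `n ≥ 1`. -/
def corrupted (ρ : ℝ) (β₀ : Control N m) (ε : ℕ → Control N m) : ℕ → Control N m
  | 0 => β₀
  | n + 1 => fun t ξ =>
      ρ • corrupted ρ β₀ ε n t ξ +
        (1 - ρ) • (G.bestResponse (corrupted ρ β₀ ε n) t ξ + ε (n + 1) t ξ)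

/-- `ε` is a sequence of (Lipschitz, orthant-valued) errors with `sup_{n ≥ 1} ‖ε n‖ = e`. -/
def IsErrorSeq (ε : ℕ → Control N m) (e : ℝ) : Prop :=
  (∀ n ≥ 1, G.Admissible (ε n)) ∧ IsLUB ((fun n => G.sNorm (ε n)) '' Ici 1) e

/-- `ℓ(ξ, ·)` is Lipschitz on bounded sets of actions. -/
def CostLocallyLipschitz : Prop :=
  ∀ ξ, ∀ R : ℝ, ∃ C : NNReal,
    LipschitzOnWith C (G.cost ξ) (orthant m ∩ Metric.closedBall 0 R)

/-- `κ` is a stability constant: an admissible control that is `δ`-close to the Markov perfect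
equilibrium, in control and in value, with `δ ∈ (0, 1]`, is a `κ δ`-Markov perfect equilibrium. -/
def IsStabilityConst (κ : ℝ) : Prop :=
  ∀ α, G.IsMPE α → ∀ γ, G.Admissible γ → ∀ δ ∈ Ioc (0 : ℝ) 1,
    G.sNorm (γ - α) + G.sNorm (G.value γ - G.value α) ≤ δ → G.IsApproxMPE (κ * δ) γ

/-- `c` is an error propagation constant for the weight `ρ` and initial controls bounded by `R`:
`sup_{n ≥ 1} (‖β̂^(n) - β^(n)‖² + ‖v̂^(n) - v^(n)‖²) ≤ c sup_{n ≥ 1} ‖ε^(n)‖²`, where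
`v^(n)` and `v̂^(n)` are the value functions for `β^(n-1)` and `β̂^(n-1)`. -/
def IsPropagationConst (ρ R c : ℝ) : Prop :=
  ∀ β₀, G.Admissible β₀ → G.sNorm β₀ ≤ R → ∀ ε e, G.IsErrorSeq ε e → ∀ n ≥ 1,
    G.sNorm (G.corrupted ρ β₀ ε n - G.picard ρ β₀ n) ^ 2 +
      G.sNorm (G.value (G.corrupted ρ β₀ ε (n - 1)) - G.value (G.picard ρ β₀ (n - 1))) ^ 2
        ≤ c * e ^ 2

end Game

end SymGame

end

/-! ### The orthant, the Hamiltonian and its minimizer -/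

namespace SymGame

/-! For a fixed control `β` of the others, the value function is the bounded solution of a
Hamilton-Jacobi-Bellman system of ordinary differential equations on a finite set. It lies between
`0` and `G.bound`, whatever `β` is, so best responses obey a bound independent of `β`
(`norm_bestResponse_le`). The central identity is `IsHJB.J_eq`: the cost of a pair `(α, β)`, minus
the value for `β₀`, is the expected time integral of the loss `hamGap` of `α` in the Hamiltonian
plus the difference of the drifts caused by `β` and `β₀`.

This identity gives verification, and Lipschitz dependence of the value on `β`. Integrating in time
against the weight `exp (K * (T - t))` gains a factor `1 / K`; strong convexity makes the minimizer
Lipschitz in the differences of the value. For large `K` the best response is therefore a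
contraction with factor `1/2` (`exists_contraction`), and errors bounded by `e` move the iterates by
at most `2 * e` in the weighted norm, for every `ρ`.

The identity also shows that a control whose `hamGap` against its own value is at most `δ`
everywhere is a `T * δ`-equilibrium (`isApproxMPE_of_hamGap_le`). Near an equilibrium with locally
Lipschitz cost the gap is of the order of the distance, which is the stability claim.

The claim on late corrupted iterates does not assume a Lipschitz cost, so it cannot be deduced from
stability, and no equilibrium enters its proof. Instead the gap is followed along the iteration
(`exists_hamGap_corrupted_le`). By convexity one step multiplies the old gap by `ρ`; the other
contributions are the increment of the value, which decays geometrically to the order of `e`, and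
the error itself. Errors point into the orthant, and in those directions convexity alone bounds the
increase of the cost linearly (`exists_cost_add_le`). Finally `c` is enlarged until `κ * (c + 1)`
dominates the resulting constant. -/

lemma isClosed_orthant (m : ℕ) : IsClosed (orthant m) := by
  simp only [orthant, ofPred_forall]
  exact isClosed_iInter fun i => isClosed_le continuous_const (by fun_prop)

lemma zero_mem_orthant (m : ℕ) : (0 : Act m) ∈ orthant m := fun i => by simp

lemma add_mem_orthant {m : ℕ} {a b : Act m} (ha : a ∈ orthant m) (hb : b ∈ orthant m) :
    a + b ∈ orthant m := fun i => by simpa using add_nonneg (ha i) (hb i)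

lemma smul_mem_orthant {m : ℕ} {c : ℝ} {a : Act m} (hc : 0 ≤ c) (ha : a ∈ orthant m) :
    c • a ∈ orthant m := fun i => by simpa using mul_nonneg hc (ha i)

lemma abs_coord_le_norm {m : ℕ} (a : Act m) (i : Fin m) : |a i| ≤ ‖a‖ := by
  simpa using PiLp.norm_apply_le a i

namespace Game

variable {N m : ℕ} (G : Game N m)

/-- The total of all multipliers of the controlled rates. -/
noncomputable def totalRate : ℝ := ∑ ξ, ∑ i, G.rate1 ξ i

lemma totalRate_nonneg : 0 ≤ G.totalRate :=
  Finset.sum_nonneg fun ξ _ => Finset.sum_nonneg fun i _ => G.rate1_nonneg ξ i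

lemma sum_rate1_le (ξ : State N m) : ∑ i, G.rate1 ξ i ≤ G.totalRate :=
  Finset.single_le_sum (f := fun ξ => ∑ i, G.rate1 ξ i)
    (fun ξ _ => Finset.sum_nonneg fun i _ => G.rate1_nonneg ξ i) (Finset.mem_univ ξ)

lemma rate1_le (ξ : State N m) (i : Fin m) : G.rate1 ξ i ≤ G.totalRate :=
  (Finset.single_le_sum (f := fun i => G.rate1 ξ i)
    (fun i _ => G.rate1_nonneg ξ i) (Finset.mem_univ i)).trans (G.sum_rate1_le ξ)

/-- The Hamiltonian, before minimization over the actions. -/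
noncomputable def ham (ξ : State N m) (p : Fin m → ℝ) (a : Act m) : ℝ :=
  G.cost ξ a + ∑ i, a i * G.rate1 ξ i * p i

lemma abs_sum_mul_rate1_le (ξ : State N m) (a : Act m) (p : Fin m → ℝ) {D : ℝ}
    (hp : ∀ i, |p i| ≤ D) : |∑ i, a i * G.rate1 ξ i * p i| ≤ G.totalRate * ‖a‖ * D := by
  -- With no coordinates the hypothesis says nothing about the sign of `D`, but then the action is
  -- zero.
  rcases isEmpty_or_nonempty (Fin m) with hm | ⟨⟨i₀⟩⟩
  · have : a = 0 := by ext i; exact hm.elim i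
    simp [this]
  have hD : 0 ≤ D := (abs_nonneg _).trans (hp i₀)
  calc |∑ i, a i * G.rate1 ξ i * p i| ≤ ∑ i, |a i * G.rate1 ξ i * p i| :=
        Finset.abs_sum_le_sum_abs _ _
    _ ≤ ∑ i, ‖a‖ * G.rate1 ξ i * D := Finset.sum_le_sum fun i _ => by
        rw [abs_mul, abs_mul, abs_of_nonneg (G.rate1_nonneg ξ i)]
        have := G.rate1_nonneg ξ i
        gcongr
        · exact abs_coord_le_norm a i
        · exact hp i
    _ = (∑ i, G.rate1 ξ i) * ‖a‖ * D := by
        rw [Finset.sum_mul, Finset.sum_mul]; exact Finset.sum_congr rfl fun i _ => by ring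
    _ ≤ G.totalRate * ‖a‖ * D := by gcongr; exact G.sum_rate1_le ξ

lemma ham_sub_ham (ξ : State N m) (p q : Fin m → ℝ) (a : Act m) :
    G.ham ξ p a - G.ham ξ q a = ∑ i, a i * G.rate1 ξ i * (p i - q i) := by
  simp only [ham, add_sub_add_left_eq_sub, ← Finset.sum_sub_distrib, mul_sub]

lemma abs_ham_sub_ham_le (ξ : State N m) {p q : Fin m → ℝ} (a : Act m) {D : ℝ}
    (h : ∀ i, |p i - q i| ≤ D) : |G.ham ξ p a - G.ham ξ q a| ≤ G.totalRate * ‖a‖ * D := by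
  rw [ham_sub_ham]
  exact G.abs_sum_mul_rate1_le ξ a _ h

lemma continuousOn_ham (ξ : State N m) (p : Fin m → ℝ) :
    ContinuousOn (G.ham ξ p) (orthant m) := by
  refine (G.cost_continuous ξ).add (Continuous.continuousOn ?_)
  fun_prop

/-- A modulus of strong convexity of the running cost. -/
noncomputable def modulus : ℝ := G.cost_strongly_convex.choose

lemma modulus_pos : 0 < G.modulus := G.cost_strongly_convex.choose_spec.1

lemma ham_strongly_convex (ξ : State N m) (p : Fin m → ℝ) {a a' : Act m} (ha : a ∈ orthant m)
    (ha' : a' ∈ orthant m) {τ : ℝ} (hτ : τ ∈ Icc (0 : ℝ) 1) :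
    G.modulus * τ * (1 - τ) * ‖a' - a‖ ^ 2 ≤
      τ * G.ham ξ p a' + (1 - τ) * G.ham ξ p a - G.ham ξ p (τ • a' + (1 - τ) • a) := by
  have h := G.cost_strongly_convex.choose_spec.2 ξ a ha a' ha' τ hτ
  have e : ∑ i, (τ • a' + (1 - τ) • a) i * G.rate1 ξ i * p i =
      τ * ∑ i, a' i * G.rate1 ξ i * p i + (1 - τ) * ∑ i, a i * G.rate1 ξ i * p i := by
    rw [Finset.mul_sum, Finset.mul_sum, ← Finset.sum_add_distrib]
    exact Finset.sum_congr rfl fun i _ => by simp; ring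
  unfold ham
  rw [e]
  change G.modulus * _ * _ * _ ≤ _ at h
  linarith

lemma ham_convex (ξ : State N m) (p : Fin m → ℝ) {a a' : Act m} (ha : a ∈ orthant m)
    (ha' : a' ∈ orthant m) {τ : ℝ} (hτ : τ ∈ Icc (0 : ℝ) 1) :
    G.ham ξ p (τ • a' + (1 - τ) • a) ≤ τ * G.ham ξ p a' + (1 - τ) * G.ham ξ p a := by
  have h := G.ham_strongly_convex ξ p ha ha' hτ
  have h0 : 0 ≤ G.modulus * τ * (1 - τ) * ‖a' - a‖ ^ 2 := by
    have := G.modulus_pos.le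
    have := hτ.1
    have := sub_nonneg.2 hτ.2
    positivity
  linarith

/-- A common bound for the cost of the zero action. -/
noncomputable def idleCost : ℝ := ∑ ξ, G.cost ξ 0

lemma cost_zero_le (ξ : State N m) : G.cost ξ 0 ≤ G.idleCost :=
  Finset.single_le_sum (f := fun ξ => G.cost ξ 0)
    (fun ξ _ => G.cost_nonneg ξ 0 (zero_mem_orthant m)) (Finset.mem_univ ξ)

lemma idleCost_nonneg : 0 ≤ G.idleCost :=
  Finset.sum_nonneg fun ξ _ => G.cost_nonneg ξ 0 (zero_mem_orthant m)

lemma ham_zero (ξ : State N m) (p : Fin m → ℝ) : G.ham ξ p 0 = G.cost ξ 0 := by simp [ham]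

lemma cost_eq_ham (ξ : State N m) : G.cost ξ = G.ham ξ 0 := by ext a; simp [ham]

/-- Strong convexity at the midpoint of `0` and `a`, where the cost is nonnegative. -/
lemma quadratic_growth (ξ : State N m) {a : Act m} (ha : a ∈ orthant m) :
    G.modulus / 2 * ‖a‖ ^ 2 - G.idleCost ≤ G.cost ξ a := by
  have h := G.ham_strongly_convex ξ 0 (zero_mem_orthant m) ha (τ := 1 / 2) (by norm_num)
  simp only [← cost_eq_ham, sub_zero] at h
  have h1 := G.cost_zero_le ξ
  have h2 := G.cost_nonneg ξ ((1 / 2 : ℝ) • a + (1 - 1 / 2 : ℝ) • 0)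
    (add_mem_orthant (smul_mem_orthant (by norm_num) ha)
      (smul_mem_orthant (by norm_num) (zero_mem_orthant m)))
  nlinarith

/-- A bound for the minimizers when the momentum variables are bounded by `P`. -/
noncomputable def actBound (P : ℝ) : ℝ :=
  1 + (2 * (2 * G.idleCost + G.totalRate * P)) / G.modulus

/-- Quadratic growth of the cost dominates the linear term of the Hamiltonian. This yields both the
coercivity needed for the existence of a minimizer and the a priori bound on it. -/
lemma norm_le_actBound_of_ham_le {P : ℝ} (hP : 0 ≤ P) (ξ : State N m) {p : Fin m → ℝ}
    (hp : ∀ i, |p i| ≤ P) {a : Act m} (ha : a ∈ orthant m) (h : G.ham ξ p a ≤ G.ham ξ p 0) :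
    ‖a‖ ≤ G.actBound P := by
  have h1 := G.quadratic_growth ξ ha
  have h2 := (abs_le.1 (G.abs_sum_mul_rate1_le ξ a p hp)).1
  rw [ham_zero] at h
  have h3 := G.cost_zero_le ξ
  have h4 : G.modulus / 2 * ‖a‖ ^ 2 ≤ 2 * G.idleCost + G.totalRate * ‖a‖ * P := by
    unfold ham at h; linarith
  have hγ := G.modulus_pos
  have hI := G.idleCost_nonneg
  have hΛ := G.totalRate_nonneg
  unfold actBound
  -- The summand `1` in `actBound` covers short actions; for the others the constant term is at most
  -- itself times `‖a‖`, and one factor `‖a‖` cancels.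
  rcases le_total ‖a‖ 1 with h5 | h5
  · have : 0 ≤ (2 * (2 * G.idleCost + G.totalRate * P)) / G.modulus := by positivity
    linarith
  · have h6 : G.modulus / 2 * ‖a‖ * ‖a‖ ≤ (2 * G.idleCost + G.totalRate * P) * ‖a‖ := by
      nlinarith
    have h7 := le_of_mul_le_mul_right h6 (by linarith)
    have : ‖a‖ ≤ (2 * (2 * G.idleCost + G.totalRate * P)) / G.modulus := by
      rw [le_div_iff₀ hγ]; linarith
    linarith

lemma actBound_nonneg {P : ℝ} (hP : 0 ≤ P) : 0 ≤ G.actBound P := by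
  have := G.modulus_pos
  have := G.idleCost_nonneg
  have := G.totalRate_nonneg
  unfold actBound
  positivity

lemma exists_isMinOn_ham (ξ : State N m) (p : Fin m → ℝ) :
    ∃ a, a ∈ orthant m ∧ IsMinOn (G.ham ξ p) (orthant m) a := by
  obtain ⟨P, hP⟩ : ∃ P : ℝ, 0 ≤ P ∧ ∀ i, |p i| ≤ P :=
    ⟨∑ i, |p i|, Finset.sum_nonneg fun i _ => abs_nonneg _, fun i =>
      Finset.single_le_sum (f := fun i => |p i|) (fun i _ => abs_nonneg _) (Finset.mem_univ i)⟩
  refine (G.continuousOn_ham ξ p).exists_isMinOn' (isClosed_orthant m) (zero_mem_orthant m) ?_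
  have h1 : ∀ᶠ a in Filter.cocompact (Act m), a ∉ Metric.closedBall (0 : Act m) (G.actBound P) :=
    (isCompact_closedBall _ _).compl_mem_cocompact
  filter_upwards [Filter.mem_inf_of_left h1, Filter.mem_inf_of_right
    (Filter.mem_principal_self _)] with a h2 h3
  by_contra h4
  exact h2 (by simpa using G.norm_le_actBound_of_ham_le hP.1 ξ hP.2 h3 (not_le.1 h4).le)

lemma argmin_spec (ξ : State N m) (p : Fin m → ℝ) :
    G.argmin ξ p ∈ orthant m ∧ IsMinOn (G.ham ξ p) (orthant m) (G.argmin ξ p) :=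
  Classical.epsilon_spec (G.exists_isMinOn_ham ξ p)

lemma argmin_mem (ξ : State N m) (p : Fin m → ℝ) : G.argmin ξ p ∈ orthant m :=
  (G.argmin_spec ξ p).1

lemma ham_argmin_le (ξ : State N m) (p : Fin m → ℝ) {a : Act m} (ha : a ∈ orthant m) :
    G.ham ξ p (G.argmin ξ p) ≤ G.ham ξ p a := (G.argmin_spec ξ p).2 ha

lemma norm_argmin_le {P : ℝ} (hP : 0 ≤ P) (ξ : State N m) {p : Fin m → ℝ}
    (hp : ∀ i, |p i| ≤ P) : ‖G.argmin ξ p‖ ≤ G.actBound P :=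
  G.norm_le_actBound_of_ham_le hP ξ hp (G.argmin_mem ξ p)
    (G.ham_argmin_le ξ p (zero_mem_orthant m))

/-- The minimum is at most the value at the midpoint of `b` and the minimizer, and strong convexity
bounds that value. -/
lemma ham_argmin_add_le (ξ : State N m) (p : Fin m → ℝ) {b : Act m} (hb : b ∈ orthant m) :
    G.ham ξ p (G.argmin ξ p) + G.modulus / 2 * ‖b - G.argmin ξ p‖ ^ 2 ≤ G.ham ξ p b := by
  have h := G.ham_strongly_convex ξ p (G.argmin_mem ξ p) hb (τ := 1 / 2) (by norm_num)
  have h1 := G.ham_argmin_le ξ p (add_mem_orthant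
    (smul_mem_orthant (c := 1 / 2) (by norm_num) hb)
    (smul_mem_orthant (c := 1 - 1 / 2) (by norm_num) (G.argmin_mem ξ p)))
  linarith

/-- The minimizer is Lipschitz in the momentum variable. -/
lemma norm_argmin_sub_le (ξ : State N m) {p q : Fin m → ℝ} {D : ℝ} (hD : 0 ≤ D)
    (h : ∀ i, |p i - q i| ≤ D) :
    ‖G.argmin ξ p - G.argmin ξ q‖ ≤ G.totalRate / G.modulus * D := by
  -- Each minimizer is a competitor for the other momentum. In the sum of the two growth
  -- inequalities the costs cancel, leaving `modulus * x ^ 2 ≤ totalRate * x * D` for the distance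
  -- `x` of the minimizers.
  have h1 := G.ham_argmin_add_le ξ p (G.argmin_mem ξ q)
  have h2 := G.ham_argmin_add_le ξ q (G.argmin_mem ξ p)
  have h3 := (abs_le.1 (G.abs_sum_mul_rate1_le ξ (G.argmin ξ q - G.argmin ξ p) (fun i => p i - q i)
    h)).2
  have e : ∑ i, (G.argmin ξ q - G.argmin ξ p) i * G.rate1 ξ i * (p i - q i) =
      (G.ham ξ p (G.argmin ξ q) - G.ham ξ q (G.argmin ξ q)) -
        (G.ham ξ p (G.argmin ξ p) - G.ham ξ q (G.argmin ξ p)) := by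
    rw [ham_sub_ham, ham_sub_ham, ← Finset.sum_sub_distrib]
    exact Finset.sum_congr rfl fun i _ => by simp; ring
  rw [e] at h3
  rw [norm_sub_rev] at h1 h3
  have hγ := G.modulus_pos
  have hΛ := G.totalRate_nonneg
  set x := ‖G.argmin ξ p - G.argmin ξ q‖
  have h4 : G.modulus * x ^ 2 ≤ G.totalRate * x * D := by linarith
  rcases (norm_nonneg _ : 0 ≤ x).eq_or_lt with h5 | h5
  · rw [show x = 0 from h5.symm]; positivity
  · rw [div_mul_eq_mul_div, le_div_iff₀ hγ]
    refine le_of_mul_le_mul_right ?_ h5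
    linarith

/-- The minimal value of the Hamiltonian is locally Lipschitz in the momentum variable. -/
lemma ham_argmin_sub_le {P : ℝ} (hP : 0 ≤ P) (ξ : State N m) {p q : Fin m → ℝ}
    (hq : ∀ i, |q i| ≤ P) {D : ℝ} (hD : 0 ≤ D)
    (h : ∀ i, |p i - q i| ≤ D) :
    G.ham ξ p (G.argmin ξ p) - G.ham ξ q (G.argmin ξ q) ≤ G.totalRate * G.actBound P * D := by
  have h1 := G.ham_argmin_le ξ p (G.argmin_mem ξ q)
  have h2 := (abs_le.1 (G.abs_ham_sub_ham_le ξ (G.argmin ξ q) h)).2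
  have h3 : G.totalRate * ‖G.argmin ξ q‖ * D ≤ G.totalRate * G.actBound P * D := by
    have := G.totalRate_nonneg
    gcongr
    exact G.norm_argmin_le hP ξ hq
  linarith

lemma exists_cost_le (A : ℝ) : ∃ C : ℝ, 0 ≤ C ∧ ∀ ξ, ∀ a ∈ orthant m, ‖a‖ ≤ A →
    G.cost ξ a ≤ C := by
  have h : ∀ ξ, ∃ C : ℝ, 0 ≤ C ∧ ∀ a ∈ orthant m, ‖a‖ ≤ A → G.cost ξ a ≤ C := fun ξ => by
    have hc : IsCompact (orthant m ∩ Metric.closedBall (0 : Act m) A) :=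
      (isCompact_closedBall _ _).inter_left (isClosed_orthant m)
    obtain ⟨C, hC⟩ := hc.bddAbove_image ((G.cost_continuous ξ).mono inter_subset_left)
    exact ⟨max C 0, le_max_right _ _, fun a ha hA => le_max_of_le_left
      (hC ⟨a, ⟨ha, by simpa using hA⟩, rfl⟩)⟩
  choose C hC0 hC using h
  exact ⟨∑ ξ, C ξ, Finset.sum_nonneg fun ξ _ => hC0 ξ, fun ξ a ha hA => (hC ξ a ha hA).trans
    (Finset.single_le_sum (f := C) (fun ξ _ => hC0 ξ) (Finset.mem_univ ξ))⟩

/-- In the directions of the orthant, the running cost increases at most linearly, although it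
need not be Lipschitz at the boundary. -/
lemma exists_cost_add_le (A : ℝ) : ∃ C : ℝ, 0 ≤ C ∧ ∀ ξ, ∀ a ∈ orthant m, ‖a‖ ≤ A →
    ∀ h ∈ orthant m, ‖h‖ ≤ 1 → G.cost ξ (a + h) ≤ G.cost ξ a + C * ‖h‖ := by
  obtain ⟨C, hC0, hC⟩ := G.exists_cost_le (A + 1)
  refine ⟨C, hC0, fun ξ a ha hA h hh h1 => ?_⟩
  rcases (norm_nonneg h).eq_or_lt with h0 | h0
  · rw [← h0, norm_eq_zero.1 h0.symm]; simp
  -- The point `a + h` lies on the segment from `a` to the point at distance one in direction `h`,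
  -- with weight `‖h‖`. The latter is in the orthant and has cost at most `C`.
  have hmem : a + ‖h‖⁻¹ • h ∈ orthant m :=
    add_mem_orthant ha (smul_mem_orthant (by positivity) hh)
  have hb := hC ξ _ hmem ((norm_add_le _ _).trans (by
    rw [norm_smul, norm_inv, norm_norm, inv_mul_cancel₀ h0.ne']; linarith))
  have hcv := G.ham_convex ξ 0 ha hmem (τ := ‖h‖) ⟨h0.le, h1⟩
  have e : ‖h‖ • (a + ‖h‖⁻¹ • h) + (1 - ‖h‖) • a = a + h := by
    rw [smul_add, smul_smul, mul_inv_cancel₀ h0.ne', sub_smul]; simp; abel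
  rw [e] at hcv
  simp only [← cost_eq_ham] at hcv
  have := G.cost_nonneg ξ a ha
  nlinarith

end Game

end SymGame

/-! ### Differential equations and the Kolmogorov forward equation -/

namespace SymGame

/-- A bounded, Lipschitz vector field has solutions on a whole compact interval. -/
lemma exists_solution_of_bounded_lipschitz {E : Type*} [NormedAddCommGroup E] [NormedSpace ℝ E]
    [CompleteSpace E] (f : ℝ → E → E) {a b t₀ : ℝ} (ht₀ : t₀ ∈ Icc a b) (x₀ : E) (K B : NNReal)
    (hlip : ∀ t ∈ Icc a b, LipschitzWith K (f t)) (hcont : ∀ x, ContinuousOn (f · x) (Icc a b))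
    (hB : ∀ t ∈ Icc a b, ∀ x, ‖f t x‖ ≤ B) :
    ∃ y : ℝ → E, y t₀ = x₀ ∧ ∀ t ∈ Icc a b, HasDerivWithinAt y (f t (y t)) (Icc a b) t := by
  -- The bound on the field is global, so the ball can be taken large enough to contain the solution
  -- for the whole interval.
  have h : IsPicardLindelof f ⟨t₀, ht₀⟩ x₀ (B * (b - a).toNNReal) 0 B K :=
    { lipschitzOnWith := fun t ht => (hlip t ht).lipschitzOnWith
      continuousOn := fun x _ => hcont x
      norm_le := fun t ht x _ => hB t ht x
      mul_max_le := by
        have := ht₀.1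
        have := ht₀.2
        rw [NNReal.coe_mul, Real.coe_toNNReal _ (by linarith), NNReal.coe_zero, sub_zero]
        refine mul_le_mul_of_nonneg_left (max_le ?_ ?_) B.2 <;> simp <;> linarith }
  exact h.exists_eq_forall_mem_Icc_hasDerivWithinAt₀

/-- A function that starts nonnegative and does not decrease where it is negative stays
nonnegative. -/
lemma nonneg_of_deriv_nonneg_of_neg {f f' : ℝ → ℝ} {a b : ℝ}
    (hf : ∀ t ∈ Icc a b, HasDerivWithinAt f (f' t) (Icc a b) t) (ha : 0 ≤ f a)
    (h : ∀ t ∈ Icc a b, f t < 0 → 0 ≤ f' t) {s : ℝ} (hs : s ∈ Icc a b) : 0 ≤ f s := by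
  by_contra! hneg
  have hc : ContinuousOn f (Icc a b) := fun t ht => (hf t ht).continuousWithinAt
  have hcs : ContinuousOn f (Icc a s) := hc.mono (Icc_subset_Icc_right hs.2)
  have hK : IsCompact (Icc a s ∩ f ⁻¹' Ici 0) :=
    isCompact_Icc.of_isClosed_subset (hcs.preimage_isClosed_of_isClosed isClosed_Icc isClosed_Ici)
      inter_subset_left
  -- `r` is the last time up to `s` at which `f` is nonnegative. Between `r` and `s` the function is
  -- negative, hence nondecreasing, which contradicts `f s < 0`.
  obtain ⟨r, ⟨hr, hr0⟩, hmax⟩ := hK.exists_isGreatest ⟨a, ⟨le_rfl, hs.1⟩, ha⟩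
  have hsub : Icc r s ⊆ Icc a b := Icc_subset_Icc hr.1 hs.2
  have hmono : MonotoneOn f (Icc r s) := by
    refine monotoneOn_of_hasDerivWithinAt_nonneg (f' := f') (convex_Icc r s) (hc.mono hsub)
      (fun x hx => ?_) fun x hx => ?_
    · exact (hf x (hsub (interior_subset hx))).mono (interior_subset.trans hsub)
    · rw [interior_Icc] at hx
      refine h x (hsub ⟨hx.1.le, hx.2.le⟩) ?_
      by_contra! h0
      exact absurd (hmax ⟨⟨hr.1.trans hx.1.le, hx.2.le⟩, h0⟩) (not_le.2 hx.1)
  have := hmono (left_mem_Icc.2 hr.2) (right_mem_Icc.2 hr.2) hr.2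
  exact absurd (le_trans hr0 this) (not_le.2 hneg)

/-- A function that ends nonnegative and does not increase where it is negative is
nonnegative. -/
lemma nonneg_of_deriv_nonpos_of_neg {f f' : ℝ → ℝ} {a b : ℝ}
    (hf : ∀ t ∈ Icc a b, HasDerivWithinAt f (f' t) (Icc a b) t) (hb : 0 ≤ f b)
    (h : ∀ t ∈ Icc a b, f t < 0 → f' t ≤ 0) {s : ℝ} (hs : s ∈ Icc a b) : 0 ≤ f s := by
  have hmaps : MapsTo (fun t => a + b - t) (Icc a b) (Icc a b) := fun t ht =>
    ⟨by linarith [ht.2], by linarith [ht.1]⟩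
  have key := nonneg_of_deriv_nonneg_of_neg (f := fun t => f (a + b - t))
    (f' := fun t => -f' (a + b - t)) (a := a) (b := b) (fun t ht => ?_) (by simpa using hb)
    (fun t ht hneg => neg_nonneg.2 (h _ (hmaps ht) hneg)) (hmaps hs)
  · simpa using key
  · have h1 : HasDerivWithinAt (fun t : ℝ => a + b - t) (-1) (Icc a b) t := by
      simpa using (hasDerivWithinAt_id t (Icc a b)).const_sub (a + b)
    have h2 := HasDerivWithinAt.comp t (hf _ (hmaps ht)) h1 hmaps
    rw [mul_neg_one] at h2
    exact h2

/-- Truncation of a number to the interval `[0, c]`. -/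
noncomputable def clip (c x : ℝ) : ℝ := max 0 (min c x)

lemma abs_clip_sub_clip_le (c x y : ℝ) : |clip c x - clip c y| ≤ |x - y| := by
  unfold clip
  refine (abs_max_sub_max_le_max _ _ _ _).trans ?_
  simp only [sub_self, abs_zero]
  refine max_le (abs_nonneg _) ((abs_min_sub_min_le_max _ _ _ _).trans ?_)
  simp

lemma clip_nonneg (c x : ℝ) : 0 ≤ clip c x := le_max_left _ _

lemma clip_le {c : ℝ} (hc : 0 ≤ c) (x : ℝ) : clip c x ≤ c := max_le hc (min_le_left _ _)

lemma clip_of_mem {c x : ℝ} (h0 : 0 ≤ x) (h1 : x ≤ c) : clip c x = x := by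
  simp [clip, h0, h1]

lemma clip_of_nonpos (c : ℝ) {x : ℝ} (h : x ≤ 0) : clip c x = 0 :=
  max_eq_left ((min_le_right _ _).trans h)

lemma clip_of_le {c x : ℝ} (hc : 0 ≤ c) (h : c ≤ x) : clip c x = c := by
  simp [clip, hc, h]

lemma continuous_clip_left (x : ℝ) : Continuous fun c => clip c x := by
  unfold clip; fun_prop

/-- The Kolmogorov forward equation of a continuous family of generators on a finite set has a
solution in the probability vectors. -/
theorem exists_forward_solution {ι : Type*} [Fintype ι] [DecidableEq ι] {a b : ℝ} (hab : a ≤ b)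
    (L : ℝ → (ι → ℝ) →ₗ[ℝ] (ι → ℝ)) (hone : ∀ u ∈ Icc a b, L u 1 = 0)
    (hpos : ∀ u ∈ Icc a b, ∀ η ζ, η ≠ ζ → 0 ≤ L u (Pi.single ζ 1) η)
    (hcont : ∀ φ η, ContinuousOn (fun u => L u φ η) (Icc a b)) (ξ : ι) :
    ∃ p : ℝ → ι → ℝ, p a = Pi.single ξ 1 ∧ ∀ u ∈ Icc a b, p u ∈ stdSimplex ℝ ι ∧
      ∀ φ : ι → ℝ, HasDerivWithinAt (fun s => ∑ η, p s η * φ η) (∑ η, p u η * L u φ η)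
        (Icc a b) u := by
  have hbd : ∃ B : ℝ, 0 ≤ B ∧ ∀ u ∈ Icc a b, ∀ η ζ, |L u (Pi.single ζ 1) η| ≤ B := by
    have h : ∀ x : ι × ι, ∃ B : ℝ, ∀ u ∈ Icc a b, |L u (Pi.single x.2 1) x.1| ≤ B := fun x => by
      simpa using isCompact_Icc.exists_bound_of_continuousOn (hcont (Pi.single x.2 1) x.1)
    choose B hB using h
    refine ⟨∑ x, |B x|, Finset.sum_nonneg fun _ _ => abs_nonneg _, fun u hu η ζ => ?_⟩
    exact ((hB (η, ζ) u hu).trans (le_abs_self _)).trans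
      (Finset.single_le_sum (f := fun x => |B x|) (fun _ _ => abs_nonneg _)
        (Finset.mem_univ (η, ζ)))
  obtain ⟨B, hB0, hB⟩ := hbd
  lift B to NNReal using hB0
  -- Truncating the coordinates to `[0, 1]` makes the field bounded and globally Lipschitz. The
  -- solution turns out to stay in the simplex, where truncation has no effect.
  let F : ℝ → (ι → ℝ) → (ι → ℝ) := fun u p ζ => ∑ η, clip 1 (p η) * L u (Pi.single ζ 1) η
  have hLsum : ∀ u (φ : ι → ℝ) η, L u φ η = ∑ ζ, φ ζ * L u (Pi.single ζ 1) η := fun u φ η => by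
    have : φ = ∑ ζ, φ ζ • (Pi.single ζ (1 : ℝ) : ι → ℝ) := by
      simpa using pi_eq_sum_univ' φ
    conv_lhs => rw [this, map_sum]
    simp [Finset.sum_apply]
  obtain ⟨p, hpa, hp⟩ := exists_solution_of_bounded_lipschitz F (left_mem_Icc.2 hab)
    (Pi.single ξ 1) (Fintype.card ι * B) (Fintype.card ι * B) (fun u hu => by
      refine LipschitzWith.of_dist_le_mul fun p q => ?_
      rw [dist_eq_norm, dist_eq_norm]
      refine (pi_norm_le_iff_of_nonneg (by positivity)).2 fun ζ => ?_
      simp only [F, Pi.sub_apply, ← Finset.sum_sub_distrib, ← sub_mul, Real.norm_eq_abs]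
      refine (Finset.abs_sum_le_sum_abs _ _).trans ?_
      calc ∑ η, |(clip 1 (p η) - clip 1 (q η)) * L u (Pi.single ζ 1) η|
          ≤ ∑ _η : ι, ‖p - q‖ * B := Finset.sum_le_sum fun η _ => by
            rw [abs_mul]
            refine mul_le_mul ((abs_clip_sub_clip_le _ _ _).trans ?_) (hB u hu η ζ)
              (abs_nonneg _) (norm_nonneg _)
            exact norm_le_pi_norm (p - q) η
        _ = _ := by simp; ring)
    (fun x => continuousOn_pi.2 fun ζ => continuousOn_finsetSum _ fun η _ =>
      continuousOn_const.mul (hcont _ _))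
    (fun u hu p => by
      refine (pi_norm_le_iff_of_nonneg (by positivity)).2 fun ζ => ?_
      simp only [F, Real.norm_eq_abs]
      refine (Finset.abs_sum_le_sum_abs _ _).trans ?_
      calc ∑ η, |clip 1 (p η) * L u (Pi.single ζ 1) η|
          ≤ ∑ _η : ι, 1 * (B : ℝ) := Finset.sum_le_sum fun η _ => by
            rw [abs_mul, abs_of_nonneg (clip_nonneg _ _)]
            exact mul_le_mul (clip_le zero_le_one _) (hB u hu η ζ) (abs_nonneg _) zero_le_one
        _ = _ := by simp)
  have hder : ∀ u ∈ Icc a b, ∀ φ : ι → ℝ, HasDerivWithinAt (fun s => ∑ ζ, p s ζ * φ ζ)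
      (∑ η, clip 1 (p u η) * L u φ η) (Icc a b) u := fun u hu φ => by
    have h1 := HasDerivWithinAt.fun_sum (u := Finset.univ) fun ζ _ =>
      (hasDerivWithinAt_pi.1 (hp u hu) ζ).mul_const (φ ζ)
    refine h1.congr_deriv ?_
    change ∑ ζ, (∑ η, clip 1 (p u η) * L u (Pi.single ζ 1) η) * φ ζ = _
    simp only [Finset.sum_mul]
    rw [Finset.sum_comm]
    refine Finset.sum_congr rfl fun η _ => ?_
    rw [hLsum, Finset.mul_sum]
    exact Finset.sum_congr rfl fun ζ _ => by ring
  have hnn : ∀ u ∈ Icc a b, ∀ ζ, 0 ≤ p u ζ := fun u hu ζ => by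
    refine nonneg_of_deriv_nonneg_of_neg (f := fun s => p s ζ)
      (fun t ht => hasDerivWithinAt_pi.1 (hp t ht) ζ) ?_ (fun t ht hneg => ?_) hu
    · simp only [hpa, Pi.single_apply]; split_ifs <;> simp
    -- At a negative coordinate the truncation removes the diagonal term, the only one that could be
    -- negative.
    · refine Finset.sum_nonneg fun η _ => ?_
      rcases eq_or_ne η ζ with rfl | hne
      · rw [clip_of_nonpos _ hneg.le, zero_mul]
      · exact mul_nonneg (clip_nonneg _ _) (hpos t ht η ζ hne)
  have hsum : ∀ u ∈ Icc a b, ∑ ζ, p u ζ = 1 := fun u hu => by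
    have h1 : ∀ t ∈ Icc a b, HasDerivWithinAt (fun s => ∑ ζ, p s ζ) 0 (Icc a b) t := fun t ht => by
      have := hder t ht 1
      simpa [hone t ht] using this
    have h2 := constant_of_has_deriv_right_zero (fun t ht => (h1 t ht).continuousWithinAt)
      (fun t ht => (h1 t ⟨ht.1, ht.2.le⟩).mono_of_mem_nhdsWithin
        (Icc_mem_nhdsGE_of_mem ht)) u hu
    rw [h2, hpa]
    simp
  have hle : ∀ u ∈ Icc a b, ∀ ζ, p u ζ ≤ 1 := fun u hu ζ => by
    rw [← hsum u hu]
    exact Finset.single_le_sum (f := fun ζ => p u ζ) (fun ζ _ => hnn u hu ζ) (Finset.mem_univ ζ)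
  refine ⟨p, hpa, fun u hu => ⟨⟨hnn u hu, hsum u hu⟩, fun φ => ?_⟩⟩
  refine (hder u hu φ).congr_deriv ?_
  exact Finset.sum_congr rfl fun η _ => by rw [clip_of_mem (hnn u hu η) (hle u hu η)]

/-! ### The controlled chain and the dynamics of the cost functional -/

namespace Game

variable {N m : ℕ} (G : Game N m)

/-- The generator of the controlled chain. -/
def generator (a b : State N m → Act m) : (State N m → ℝ) →ₗ[ℝ] (State N m → ℝ) where
  toFun φ ξ := G.genOwn a φ ξ + G.genOthers b φ ξ
  map_add' φ ψ := by
    ext ξ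
    simp only [genOwn, genOthers, Pi.add_apply, add_sub_add_comm, mul_add, Finset.sum_add_distrib]
    ring
  map_smul' c φ := by
    ext ξ
    simp only [genOwn, genOthers, Pi.smul_apply, smul_eq_mul, ← mul_sub, RingHom.id_apply,
      mul_add, Finset.mul_sum]
    congr 1
    · exact Finset.sum_congr rfl fun i _ => by ring
    · exact Finset.sum_congr rfl fun z _ => Finset.sum_congr rfl fun i _ => by ring

variable {G}

/-- The positive maximum principle for the generator of the controlled chain. -/
lemma generator_nonneg {a b : State N m → Act m} (ha : ∀ ξ, a ξ ∈ orthant m)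
    (hb : ∀ ξ, b ξ ∈ orthant m) {φ : State N m → ℝ} {ξ : State N m} (h : ∀ η, φ ξ ≤ φ η) :
    0 ≤ G.generator a b φ ξ :=
  add_nonneg (Finset.sum_nonneg fun i _ => mul_nonneg (add_nonneg (G.rate0_nonneg _ _)
    (mul_nonneg (G.rate1_nonneg _ _) (ha _ i))) (sub_nonneg.2 (h _)))
    (Finset.sum_nonneg fun _ _ => Finset.sum_nonneg fun i _ => mul_nonneg
      (mul_nonneg (Nat.cast_nonneg _) (add_nonneg (G.rate0_nonneg _ _)
        (mul_nonneg (G.rate1_nonneg _ _) (hb _ i)))) (sub_nonneg.2 (h _)))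

lemma generator_nonpos {a b : State N m → Act m} (ha : ∀ ξ, a ξ ∈ orthant m)
    (hb : ∀ ξ, b ξ ∈ orthant m) {φ : State N m → ℝ} {ξ : State N m} (h : ∀ η, φ η ≤ φ ξ) :
    G.generator a b φ ξ ≤ 0 := by
  have := generator_nonneg (G := G) ha hb (φ := -φ) (ξ := ξ) fun η => neg_le_neg (h η)
  rw [map_neg, Pi.neg_apply] at this
  linarith

lemma Admissible.continuousOn {α : Control N m} (hα : G.Admissible α) (ξ : State N m) :
    ContinuousOn (fun t => α t ξ) (Icc 0 G.T) := by
  obtain ⟨⟨K, hK⟩, -⟩ := hα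
  exact (hK ξ).continuousOn

lemma Admissible.continuousOn_coord {α : Control N m} (hα : G.Admissible α) (ξ : State N m)
    (i : Fin m) : ContinuousOn (fun t => α t ξ i) (Icc 0 G.T) :=
  (PiLp.continuous_apply 2 (fun _ : Fin m => ℝ) i).comp_continuousOn (hα.continuousOn ξ)

lemma Admissible.exists_norm_le {α : Control N m} (hα : G.Admissible α) :
    ∃ A : ℝ, 0 ≤ A ∧ ∀ t ∈ Icc 0 G.T, ∀ ξ, ‖α t ξ‖ ≤ A := by
  choose A hA using fun ξ => isCompact_Icc.exists_bound_of_continuousOn (hα.continuousOn ξ)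
  exact ⟨∑ ξ, |A ξ|, Finset.sum_nonneg fun _ _ => abs_nonneg _, fun t ht ξ =>
    ((hA ξ t ht).trans (le_abs_self _)).trans
      (Finset.single_le_sum (f := fun ξ => |A ξ|) (fun _ _ => abs_nonneg _) (Finset.mem_univ ξ))⟩

lemma Admissible.continuousOn_genOwn {α : Control N m} (hα : G.Admissible α)
    {w : ℝ → State N m → ℝ} (hw : ∀ η, ContinuousOn (fun t => w t η) (Icc 0 G.T))
    (ξ : State N m) : ContinuousOn (fun t => G.genOwn (α t) (w t) ξ) (Icc 0 G.T) :=
  continuousOn_finsetSum _ fun i _ =>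
    (continuousOn_const.add (continuousOn_const.mul (hα.continuousOn_coord ξ i))).mul
      ((hw _).sub (hw _))

lemma Admissible.continuousOn_genOthers {β : Control N m} (hβ : G.Admissible β)
    {w : ℝ → State N m → ℝ} (hw : ∀ η, ContinuousOn (fun t => w t η) (Icc 0 G.T))
    (ξ : State N m) : ContinuousOn (fun t => G.genOthers (β t) (w t) ξ) (Icc 0 G.T) :=
  continuousOn_finsetSum _ fun _ _ => continuousOn_finsetSum _ fun i _ =>
    (continuousOn_const.mul (continuousOn_const.add
      (continuousOn_const.mul (hβ.continuousOn_coord _ i)))).mul ((hw _).sub (hw _))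

/-- The controlled chain has transition probabilities. -/
lemma isTransition_transition {α β : Control N m} (hα : G.Admissible α) (hβ : G.Admissible β)
    {t : ℝ} (ht : t ∈ Icc 0 G.T) (ξ : State N m) :
    G.IsTransition α β t ξ (G.transition α β t ξ) := by
  refine Classical.epsilon_spec (p := G.IsTransition α β t ξ) ?_
  have hsub : Icc t G.T ⊆ Icc 0 G.T := Icc_subset_Icc_left ht.1
  have hone : ∀ u ∈ Icc t G.T, G.generator (α u) (β u) 1 = 0 := fun u _ => by
    ext ξ
    simp [generator, genOwn, genOthers]
  have hpos : ∀ u ∈ Icc t G.T, ∀ η ζ, η ≠ ζ →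
      0 ≤ G.generator (α u) (β u) (Pi.single ζ 1) η := fun u hu η ζ hne => by
    refine generator_nonneg (hα.2 u (hsub hu)) (hβ.2 u (hsub hu)) fun θ => ?_
    rw [Pi.single_eq_of_ne hne, Pi.single_apply]
    split_ifs <;> simp
  have hcont : ∀ φ η, ContinuousOn (fun u => G.generator (α u) (β u) φ η) (Icc t G.T) :=
    fun φ η => ((hα.continuousOn_genOwn (w := fun _ => φ) (fun _ => continuousOn_const) η).add
      (hβ.continuousOn_genOthers (w := fun _ => φ) (fun _ => continuousOn_const) η)).mono hsub
  obtain ⟨p, hp0, hp⟩ := exists_forward_solution ht.2 (fun u => G.generator (α u) (β u))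
    hone hpos hcont ξ
  exact ⟨p, fun η => by rw [hp0, Pi.single_apply], hp⟩

variable (G)

lemma continuousOn_ham_comp (ξ : State N m) {S : Set ℝ} {a : ℝ → Act m} {p : ℝ → Fin m → ℝ}
    (ha : ContinuousOn a S) (hmem : ∀ t ∈ S, a t ∈ orthant m)
    (hp : ∀ i, ContinuousOn (fun t => p t i) S) : ContinuousOn (fun t => G.ham ξ (p t) (a t)) S :=
  ((G.cost_continuous ξ).comp ha hmem).add (continuousOn_finsetSum _ fun i _ =>
    (((PiLp.continuous_apply 2 (fun _ : Fin m => ℝ) i).comp_continuousOn ha).mul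
      continuousOn_const).mul (hp i))

lemma continuous_argmin (ξ : State N m) : Continuous (G.argmin ξ) := by
  have h0 : 0 ≤ G.totalRate / G.modulus := div_nonneg G.totalRate_nonneg G.modulus_pos.le
  have : LipschitzWith ⟨G.totalRate / G.modulus, h0⟩ (G.argmin ξ) :=
    LipschitzWith.of_dist_le_mul fun p q => by
      rw [dist_eq_norm, dist_eq_norm]
      exact G.norm_argmin_sub_le ξ (norm_nonneg _) fun i => norm_le_pi_norm (p - q) i
  exact this.continuous

/-- The controlled part of the own drift joins the running cost to form the Hamiltonian; only the
uncontrolled drift, with control `0`, remains outside. -/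
lemma cost_add_genOwn (a : State N m → Act m) (φ : State N m → ℝ) (ξ : State N m) :
    G.cost ξ (a ξ) + G.genOwn a φ ξ = G.ham ξ (diff φ ξ) (a ξ) + G.genOwn 0 φ ξ := by
  have : G.genOwn a φ ξ = ∑ i, a ξ i * G.rate1 ξ i * diff φ ξ i + G.genOwn 0 φ ξ := by
    unfold genOwn diff
    rw [← Finset.sum_add_distrib]
    exact Finset.sum_congr rfl fun i _ => by simp; ring
  rw [this, ham, add_assoc]

variable {G}

lemma IsTransition.exists_hasDerivWithinAt {α β : Control N m} {t : ℝ} {ξ : State N m}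
    {p : ℝ → State N m → ℝ} (hp : G.IsTransition α β t ξ p) (η : State N m) {u : ℝ}
    (hu : u ∈ Icc t G.T) : ∃ r, HasDerivWithinAt (fun s => p s η) r (Icc t G.T) u := by
  have := (hp.2 u hu).2 (Pi.single η 1)
  simp only [Pi.single_apply, mul_ite, mul_one, mul_zero, Finset.sum_ite_eq',
    Finset.mem_univ, if_true] at this
  exact ⟨_, this⟩

lemma IsTransition.continuousOn {α β : Control N m} {t : ℝ} {ξ : State N m}
    {p : ℝ → State N m → ℝ} (hp : G.IsTransition α β t ξ p) (η : State N m) :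
    ContinuousOn (fun s => p s η) (Icc t G.T) := fun _ hu =>
  (hp.exists_hasDerivWithinAt η hu).choose_spec.continuousWithinAt

/-- The dynamics of the cost functional: its difference to a function with the same terminal
values is the expected integral of running cost and drift. -/
theorem J_eq_add_integral {α β : Control N m} (hα : G.Admissible α) (hβ : G.Admissible β)
    {w w' : ℝ → State N m → ℝ} (hterm : w G.T = G.terminal)
    (hw : ∀ u ∈ Icc 0 G.T, ∀ η, HasDerivWithinAt (fun s => w s η) (w' u η) (Icc 0 G.T) u)
    (hw' : ∀ η, ContinuousOn (fun u => w' u η) (Icc 0 G.T))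
    {t : ℝ} (ht : t ∈ Icc 0 G.T) (ξ : State N m) :
    J G t ξ α β = w t ξ + ∫ u in t..G.T, ∑ η, G.transition α β t ξ u η *
      (G.cost η (α u η) + G.genOwn (α u) (w u) η + G.genOthers (β u) (w u) η + w' u η) := by
  have hsub : Icc t G.T ⊆ Icc 0 G.T := Icc_subset_Icc_left ht.1
  obtain ⟨hp0, hp⟩ := isTransition_transition hα hβ ht ξ
  set p := G.transition α β t ξ
  have hwc : ∀ η, ContinuousOn (fun u => w u η) (Icc 0 G.T) := fun η u hu =>
    (hw u hu η).continuousWithinAt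
  have hpc : ∀ η, ∀ u ∈ Icc t G.T, ∃ r, HasDerivWithinAt (fun s => p s η) r (Icc t G.T) u :=
    fun η u hu => IsTransition.exists_hasDerivWithinAt ⟨hp0, hp⟩ η hu
  have hpcont : ∀ η, ContinuousOn (fun s => p s η) (Icc t G.T) :=
    IsTransition.continuousOn ⟨hp0, hp⟩
  have hder : ∀ u ∈ Icc t G.T, HasDerivWithinAt (fun s => ∑ η, p s η * w s η)
      (∑ η, p u η * (G.genOwn (α u) (w u) η + G.genOthers (β u) (w u) η + w' u η))
      (Icc t G.T) u := fun u hu => by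
    -- The forward equation is tested against functions constant in time, so `w` is frozen at time
    -- `u`. In the remainder `w s - w u` the derivative of `p` drops out, as its factor vanishes at
    -- `s = u`.
    have h1 := (hp u hu).2 (w u)
    have h2 : HasDerivWithinAt (fun s => ∑ η, p s η * (w s η - w u η)) (∑ η, p u η * w' u η)
        (Icc t G.T) u := by
      refine HasDerivWithinAt.fun_sum fun η _ => ?_
      obtain ⟨r, hr⟩ := hpc η u hu
      have h3 := hr.mul (((hw u (hsub hu) η).mono hsub).sub_const (w u η))
      exact h3.congr_deriv (by simp)
    refine ((h1.add h2).congr_deriv ?_).congr_of_mem (fun s _ => ?_) hu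
    · rw [← Finset.sum_add_distrib]
      exact Finset.sum_congr rfl fun η _ => by ring
    · rw [Pi.add_apply]
      rw [← Finset.sum_add_distrib]
      exact Finset.sum_congr rfl fun η _ => by ring
  have hcost : ContinuousOn (fun u => ∑ η, p u η * G.cost η (α u η)) (Icc t G.T) :=
    continuousOn_finsetSum _ fun η _ => (hpcont η).mul
      (((G.cost_continuous η).comp (hα.continuousOn η) (fun s hs => hα.2 s hs η)).mono hsub)
  have hdrift : ContinuousOn (fun u => ∑ η, p u η *
      (G.genOwn (α u) (w u) η + G.genOthers (β u) (w u) η + w' u η)) (Icc t G.T) :=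
    continuousOn_finsetSum _ fun η _ => (hpcont η).mul
      ((((hα.continuousOn_genOwn hwc η).add (hβ.continuousOn_genOthers hwc η)).add (hw' η)).mono
        hsub)
  have hftc := intervalIntegral.integral_eq_sub_of_hasDerivAt_of_le ht.2
    (fun u hu => (hder u hu).continuousWithinAt)
    (fun u hu => (hder u (Ioo_subset_Icc_self hu)).hasDerivAt (Icc_mem_nhds hu.1 hu.2))
    (hdrift.intervalIntegrable_of_Icc ht.2)
  have hstart : ∑ η, p t η * w t η = w t ξ := by simp [hp0]
  have hsplit : ∫ u in t..G.T, ∑ η, p u η *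
      (G.cost η (α u η) + G.genOwn (α u) (w u) η + G.genOthers (β u) (w u) η + w' u η) =
      (∫ u in t..G.T, ∑ η, p u η * G.cost η (α u η)) + ∫ u in t..G.T, ∑ η, p u η *
        (G.genOwn (α u) (w u) η + G.genOthers (β u) (w u) η + w' u η) := by
    rw [← intervalIntegral.integral_add (hcost.intervalIntegrable_of_Icc ht.2)
      (hdrift.intervalIntegrable_of_Icc ht.2)]
    refine intervalIntegral.integral_congr fun u _ => ?_
    rw [← Finset.sum_add_distrib]
    exact Finset.sum_congr rfl fun η _ => by ring
  rw [hsplit, hftc, hstart, hterm, J]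
  ring

/-! ### Existence for the Hamilton-Jacobi-Bellman equation -/

variable (G)

/-- An a priori bound for the value functions at time `t`. -/
noncomputable def bound (t : ℝ) : ℝ := ∑ ξ, G.terminal ξ + G.idleCost * (G.T - t)

lemma bound_nonneg {t : ℝ} (ht : t ≤ G.T) : 0 ≤ G.bound t :=
  add_nonneg (Finset.sum_nonneg fun ξ _ => G.terminal_nonneg ξ)
    (mul_nonneg G.idleCost_nonneg (sub_nonneg.2 ht))

lemma bound_le_bound_zero {t : ℝ} (ht : 0 ≤ t) : G.bound t ≤ G.bound 0 := by
  have := mul_nonneg G.idleCost_nonneg ht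
  unfold bound
  linarith

/-- The minimized Hamiltonian, together with the drift from all uncontrolled transitions and from
the transitions of the other players. -/
noncomputable def hjbOperator (b : State N m → Act m) (φ : State N m → ℝ) (ξ : State N m) : ℝ :=
  G.ham ξ (diff φ ξ) (G.argmin ξ (diff φ ξ)) + G.generator 0 b φ ξ

/-- Bounded solutions of the Hamilton-Jacobi-Bellman equation of the tagged player, when the other
players use `β`. -/
structure IsHJB (β : Control N m) (w : ℝ → State N m → ℝ) : Prop where
  terminal_eq : w G.T = G.terminal
  deriv : ∀ t ∈ Icc 0 G.T, ∀ ξ,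
    HasDerivWithinAt (fun s => w s ξ) (-G.hjbOperator (β t) (w t) ξ) (Icc 0 G.T) t
  nonneg : ∀ t ∈ Icc 0 G.T, ∀ ξ, 0 ≤ w t ξ
  le_bound : ∀ t ∈ Icc 0 G.T, ∀ ξ, w t ξ ≤ G.bound t

lemma admissible_zero : G.Admissible 0 :=
  ⟨⟨0, fun _ => (LipschitzWith.const 0).lipschitzOnWith⟩, fun _ _ _ => zero_mem_orthant m⟩

lemma continuousOn_hjbOperator {β : Control N m} (hβ : G.Admissible β) {w : ℝ → State N m → ℝ}
    (hw : ∀ η, ContinuousOn (fun t => w t η) (Icc 0 G.T)) (ξ : State N m) :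
    ContinuousOn (fun t => G.hjbOperator (β t) (w t) ξ) (Icc 0 G.T) := by
  have hdiff : ∀ i, ContinuousOn (fun t => diff (w t) ξ i) (Icc 0 G.T) := fun i =>
    (hw _).sub (hw _)
  refine (G.continuousOn_ham_comp ξ ((G.continuous_argmin ξ).comp_continuousOn
    (continuousOn_pi.2 hdiff)) (fun t _ => G.argmin_mem ξ _) hdiff).add ?_
  exact (G.admissible_zero.continuousOn_genOwn hw ξ).add (hβ.continuousOn_genOthers hw ξ)

/-- The total of all uncontrolled rates. -/
noncomputable def totalRate0 : ℝ := ∑ ξ, ∑ i, G.rate0 ξ i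

lemma rate0_le (ξ : State N m) (i : Fin m) : G.rate0 ξ i ≤ G.totalRate0 :=
  (Finset.single_le_sum (f := fun i => G.rate0 ξ i)
    (fun i _ => G.rate0_nonneg ξ i) (Finset.mem_univ i)).trans
    (Finset.single_le_sum (f := fun ξ => ∑ i, G.rate0 ξ i)
      (fun ξ _ => Finset.sum_nonneg fun i _ => G.rate0_nonneg ξ i) (Finset.mem_univ ξ))

lemma totalRate0_nonneg : 0 ≤ G.totalRate0 :=
  Finset.sum_nonneg fun ξ _ => Finset.sum_nonneg fun i _ => G.rate0_nonneg ξ i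

lemma occ_le (n : Occ N m) (z : Fin (m + 1)) : (n.1 z : ℝ) ≤ N := by
  have : n.1 z ≤ N := by
    conv_rhs => rw [← n.2]
    exact Finset.single_le_sum (f := n.1) (fun _ _ => Nat.zero_le _) (Finset.mem_univ z)
  exact_mod_cast this

lemma abs_sub_le_two_mul {φ : State N m → ℝ} {D : ℝ} (hφ : ∀ η, |φ η| ≤ D) (ξ η : State N m) :
    |φ ξ - φ η| ≤ 2 * D := by
  have := abs_sub (φ ξ) (φ η)
  linarith [hφ ξ, hφ η]

/-- Bounds for generators, with bounded controls of the other players. -/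
lemma exists_abs_generator_le (A : ℝ) (hA : 0 ≤ A) : ∃ C : ℝ, 0 ≤ C ∧
    ∀ b : State N m → Act m, (∀ ξ, ‖b ξ‖ ≤ A) → ∀ φ : State N m → ℝ, ∀ D : ℝ,
      (∀ η, |φ η| ≤ D) → ∀ ξ, |G.generator 0 b φ ξ| ≤ C * D := by
  have hΛ := G.totalRate_nonneg
  have hΛ0 := G.totalRate0_nonneg
  refine ⟨m * (G.totalRate0 * 2) + (m + 1) * (m * (N * (G.totalRate0 + G.totalRate * A) * 2)),
    by positivity, fun b hb φ D hD ξ => ?_⟩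
  have hD0 : 0 ≤ D := (abs_nonneg _).trans (hD ξ)
  have h1 : |G.genOwn 0 φ ξ| ≤ ∑ _i : Fin m, G.totalRate0 * (2 * D) :=
    (Finset.abs_sum_le_sum_abs _ _).trans (Finset.sum_le_sum fun i _ => by
      simp only [Pi.zero_apply, PiLp.zero_apply, mul_zero, add_zero]
      rw [abs_mul, abs_of_nonneg (G.rate0_nonneg _ _)]
      exact mul_le_mul (G.rate0_le _ _) (abs_sub_le_two_mul hD _ _) (abs_nonneg _) hΛ0)
  have h2 : |G.genOthers b φ ξ| ≤ ∑ _z : Fin (m + 1), ∑ _i : Fin m,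
      N * (G.totalRate0 + G.totalRate * A) * (2 * D) :=
    (Finset.abs_sum_le_sum_abs _ _).trans (Finset.sum_le_sum fun z _ =>
      (Finset.abs_sum_le_sum_abs _ _).trans (Finset.sum_le_sum fun i _ => by
        rw [abs_mul, abs_mul, Nat.abs_cast]
        refine mul_le_mul (mul_le_mul (occ_le _ _) ((abs_add_le _ _).trans (add_le_add ?_ ?_))
          (abs_nonneg _) (by positivity)) (abs_sub_le_two_mul hD _ _) (abs_nonneg _)
          (by positivity)
        · rw [abs_of_nonneg (G.rate0_nonneg _ _)]
          exact G.rate0_le _ _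
        · rw [abs_mul, abs_of_nonneg (G.rate1_nonneg _ _)]
          exact mul_le_mul (G.rate1_le _ _) ((abs_coord_le_norm _ _).trans (hb _)) (abs_nonneg _)
            hΛ))
  refine (abs_add_le _ _).trans ((add_le_add h1 h2).trans (le_of_eq ?_))
  simp
  ring

/-- The drift from the other players is Lipschitz in their control. -/
lemma exists_abs_genOthers_sub_le : ∃ C : ℝ, 0 ≤ C ∧
    ∀ b b' : State N m → Act m, ∀ A, (∀ ξ, ‖b ξ - b' ξ‖ ≤ A) → ∀ φ : State N m → ℝ, ∀ D : ℝ,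
      (∀ η, |φ η| ≤ D) → ∀ ξ, |G.genOthers b φ ξ - G.genOthers b' φ ξ| ≤ C * A * D := by
  have hΛ := G.totalRate_nonneg
  refine ⟨(m + 1) * (m * (N * G.totalRate * 2)), by positivity, fun b b' A hA φ D hD ξ => ?_⟩
  have hD0 : 0 ≤ D := (abs_nonneg _).trans (hD ξ)
  have hA0 : 0 ≤ A := (norm_nonneg _).trans (hA ξ)
  have h2 : |G.genOthers b φ ξ - G.genOthers b' φ ξ| ≤ ∑ _z : Fin (m + 1), ∑ _i : Fin m,
      N * (G.totalRate * A) * (2 * D) := by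
    unfold genOthers
    rw [← Finset.sum_sub_distrib]
    refine (Finset.abs_sum_le_sum_abs _ _).trans (Finset.sum_le_sum fun z _ => ?_)
    rw [← Finset.sum_sub_distrib]
    refine (Finset.abs_sum_le_sum_abs _ _).trans (Finset.sum_le_sum fun i _ => ?_)
    rw [← sub_mul, ← mul_sub, add_sub_add_left_eq_sub, ← mul_sub, abs_mul, abs_mul, abs_mul,
      Nat.abs_cast, abs_of_nonneg (G.rate1_nonneg _ _)]
    refine mul_le_mul (mul_le_mul (occ_le _ _) (mul_le_mul (G.rate1_le _ _) ?_ (abs_nonneg _) hΛ)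
      (mul_nonneg (G.rate1_nonneg _ _) (abs_nonneg _)) (by positivity))
      (abs_sub_le_two_mul hD _ _) (abs_nonneg _) (by positivity)
    exact (abs_coord_le_norm (b _ - b' _) i).trans (hA _)
  refine h2.trans (le_of_eq ?_)
  simp
  ring

/-- The Hamilton-Jacobi-Bellman equation has a solution. -/
theorem exists_isHJB {β : Control N m} (hβ : G.Admissible β) : ∃ w, G.IsHJB β w := by
  obtain ⟨A, hA0, hA⟩ := hβ.exists_norm_le
  obtain ⟨C, hC0, hC⟩ := G.exists_abs_generator_le A hA0
  have hT := G.T_pos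
  set M := G.bound 0
  have hM0 : 0 ≤ M := G.bound_nonneg hT.le
  have hΛ := G.totalRate_nonneg
  have hAM := G.actBound_nonneg hM0
  have hI := G.idleCost_nonneg
  -- The minimized Hamiltonian is only locally Lipschitz, so its argument is truncated to `[0,
  -- G.bound t]`. The maximum principle below shows that the solution respects these bounds.
  let cl : ℝ → (State N m → ℝ) → State N m → ℝ := fun t y η => clip (G.bound t) (y η)
  have hcl : ∀ t ∈ Icc 0 G.T, ∀ y η, cl t y η ∈ Icc 0 M := fun t ht y η =>
    ⟨clip_nonneg _ _, (clip_le (G.bound_nonneg ht.2) _).trans (G.bound_le_bound_zero ht.1)⟩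
  have hclabs : ∀ t ∈ Icc 0 G.T, ∀ y η, |cl t y η| ≤ M := fun t ht y η =>
    abs_le.2 ⟨by linarith [(hcl t ht y η).1], (hcl t ht y η).2⟩
  have hdiff : ∀ t ∈ Icc 0 G.T, ∀ y ξ i, |diff (cl t y) ξ i| ≤ M := fun t ht y ξ i =>
    abs_sub_le_of_nonneg_of_le (hcl t ht y _).1 (hcl t ht y _).2 (hcl t ht y _).1 (hcl t ht y _).2
  have hcldist : ∀ t y z η, |cl t y η - cl t z η| ≤ ‖y - z‖ := fun t y z η =>
    (abs_clip_sub_clip_le _ _ _).trans (norm_le_pi_norm (y - z) η)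
  let F : ℝ → (State N m → ℝ) → State N m → ℝ := fun t y ξ => -G.hjbOperator (β t) (cl t y) ξ
  have hFlip : ∀ t ∈ Icc 0 G.T, ∀ y z ξ, F t y ξ - F t z ξ ≤
      (2 * (G.totalRate * G.actBound M) + C) * ‖y - z‖ := fun t ht y z ξ => by
    have h1 := G.ham_argmin_sub_le hM0 ξ (p := diff (cl t z) ξ) (hdiff t ht y ξ)
      (D := 2 * ‖y - z‖) (by positivity) (fun i => by
        have := abs_sub_le_two_mul (fun η => by
          rw [abs_sub_comm]; exact hcldist t y z η : ∀ η, |cl t z η - cl t y η| ≤ ‖y - z‖)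
          (ξ.1.succAbove i, ξ.2) ξ
        unfold diff
        convert this using 2
        ring)
    have h2 := (abs_le.1 (hC (β t) (hA t ht) (cl t z - cl t y) ‖y - z‖ (fun η => by
      rw [Pi.sub_apply, abs_sub_comm]; exact hcldist t y z η) ξ)).2
    rw [map_sub, Pi.sub_apply] at h2
    simp only [F, hjbOperator]
    linarith
  have hFbd : ∀ t ∈ Icc 0 G.T, ∀ y ξ, |F t y ξ| ≤
      G.idleCost + G.totalRate * G.actBound M * M + C * M := fun t ht y ξ => by
    have h1 := abs_le.1 (hC (β t) (hA t ht) (cl t y) M (hclabs t ht y) ξ)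
    have h2 := G.ham_argmin_le ξ (diff (cl t y) ξ) (zero_mem_orthant m)
    rw [ham_zero] at h2
    have h3 := G.cost_zero_le ξ
    have h4 := (abs_le.1 (G.abs_sum_mul_rate1_le ξ (G.argmin ξ (diff (cl t y) ξ))
      (diff (cl t y) ξ) (hdiff t ht y ξ))).1
    have h5 : G.totalRate * ‖G.argmin ξ (diff (cl t y) ξ)‖ * M ≤
        G.totalRate * G.actBound M * M := by
      gcongr
      exact G.norm_argmin_le hM0 ξ (hdiff t ht y ξ)
    have h6 := G.cost_nonneg ξ _ (G.argmin_mem ξ (diff (cl t y) ξ))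
    have h7 : 0 ≤ G.totalRate * G.actBound M * M := by positivity
    simp only [F, hjbOperator, abs_neg]
    refine abs_le.2 ⟨?_, by linarith [h1.2]⟩
    have : G.ham ξ (diff (cl t y) ξ) (G.argmin ξ (diff (cl t y) ξ)) ≥
        -(G.totalRate * G.actBound M * M) := by
      unfold ham; linarith
    linarith [h1.1]
  have hL0 : 0 ≤ 2 * (G.totalRate * G.actBound M) + C := by positivity
  have hB0 : 0 ≤ G.idleCost + G.totalRate * G.actBound M * M + C * M := by positivity
  obtain ⟨w, hwT, hw⟩ := exists_solution_of_bounded_lipschitz F (right_mem_Icc.2 hT.le) G.terminal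
    ⟨_, hL0⟩ ⟨_, hB0⟩ (fun t ht => LipschitzWith.of_dist_le_mul fun y z => by
      rw [dist_eq_norm, dist_eq_norm]
      refine (pi_norm_le_iff_of_nonneg (mul_nonneg hL0 (norm_nonneg _))).2 fun ξ => ?_
      rw [Pi.sub_apply, Real.norm_eq_abs]
      refine abs_sub_le_iff.2 ⟨hFlip t ht y z ξ, ?_⟩
      have := hFlip t ht z y ξ
      rwa [norm_sub_rev] at this)
    (fun y => continuousOn_pi.2 fun ξ => (G.continuousOn_hjbOperator hβ (w := fun t => cl t y)
      (fun η => ((continuous_clip_left (y η)).comp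
        (by unfold bound; fun_prop : Continuous G.bound)).continuousOn) ξ).neg)
    (fun t ht y => (pi_norm_le_iff_of_nonneg hB0).2 fun ξ => hFbd t ht y ξ)
  have hwd : ∀ t ∈ Icc 0 G.T, ∀ ξ, HasDerivWithinAt (fun s => w s ξ) (F t (w t) ξ)
      (Icc 0 G.T) t := fun t ht ξ => hasDerivWithinAt_pi.1 (hw t ht) ξ
  have hz : ∀ ξ : State N m, (0 : State N m → Act m) ξ ∈ orthant m := fun ξ => zero_mem_orthant m
  have hnn : ∀ t ∈ Icc 0 G.T, ∀ ξ, 0 ≤ w t ξ := fun t ht ξ => by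
    refine nonneg_of_deriv_nonpos_of_neg (fun t ht => hwd t ht ξ) ?_ (fun t ht hneg => ?_) ht
    · simpa only [hwT] using G.terminal_nonneg ξ
    -- Where the solution is negative, its truncation has a minimum; all rates multiply nonnegative
    -- differences, so the operator is nonnegative there.
    · have h0 : cl t (w t) ξ = 0 := clip_of_nonpos _ hneg.le
      have hmin : ∀ η, cl t (w t) ξ ≤ cl t (w t) η := fun η => h0 ▸ clip_nonneg _ _
      refine neg_nonpos.2 (add_nonneg (add_nonneg (G.cost_nonneg ξ _ (G.argmin_mem ξ _))
        (Finset.sum_nonneg fun i _ => mul_nonneg (mul_nonneg (G.argmin_mem ξ _ i)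
          (G.rate1_nonneg ξ i)) (sub_nonneg.2 (hmin _))))
        (generator_nonneg hz (hβ.2 t ht) hmin))
  have hle : ∀ t ∈ Icc 0 G.T, ∀ ξ, w t ξ ≤ G.bound t := fun t ht ξ => by
    refine sub_nonneg.1 (nonneg_of_deriv_nonpos_of_neg (f := fun t => G.bound t - w t ξ)
      (f' := fun t => -G.idleCost - F t (w t) ξ) (fun t ht => ?_) ?_ (fun t ht hneg => ?_) ht)
    · refine HasDerivWithinAt.sub ?_ (hwd t ht ξ)
      have := (((hasDerivWithinAt_id t (Icc 0 G.T)).const_sub G.T).const_mul G.idleCost).const_add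
        (∑ ξ, G.terminal ξ)
      rw [mul_neg_one] at this
      exact this
    · simp only [hwT, bound, sub_self, mul_zero, add_zero, sub_nonneg]
      exact Finset.single_le_sum (fun ξ _ => G.terminal_nonneg ξ) (Finset.mem_univ ξ)
    -- Above the bound the truncation has a maximum. The drift is nonpositive there, and comparison
    -- with the zero action bounds the Hamiltonian by `idleCost`, the rate at which `bound`
    -- decreases.
    · have h0 : cl t (w t) ξ = G.bound t :=
        clip_of_le (G.bound_nonneg ht.2) (sub_neg.1 hneg).le
      have hmax : ∀ η, cl t (w t) η ≤ cl t (w t) ξ := fun η =>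
        h0 ▸ clip_le (G.bound_nonneg ht.2) _
      have h1 := generator_nonpos (G := G) hz (hβ.2 t ht) hmax
      have h2 := G.ham_argmin_le ξ (diff (cl t (w t)) ξ) (zero_mem_orthant m)
      rw [ham_zero] at h2
      have h3 := G.cost_zero_le ξ
      simp only [F, hjbOperator]
      linarith
  refine ⟨w, hwT, fun t ht ξ => ?_, hnn, hle⟩
  have : cl t (w t) = w t := by
    ext η
    exact clip_of_mem (hnn t ht η) (hle t ht η)
  have h := hwd t ht ξ
  simp only [F, this] at h
  exact h

/-! ### Verification and the value function -/

variable {G}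

lemma IsHJB.continuousOn {β : Control N m} {w : ℝ → State N m → ℝ} (hw : G.IsHJB β w)
    (ξ : State N m) : ContinuousOn (fun t => w t ξ) (Icc 0 G.T) := fun t ht =>
  (hw.deriv t ht ξ).continuousWithinAt

lemma IsHJB.mem_Icc {β : Control N m} {w : ℝ → State N m → ℝ} (hw : G.IsHJB β w) {t : ℝ}
    (ht : t ∈ Icc 0 G.T) (ξ : State N m) : w t ξ ∈ Icc 0 (G.bound 0) :=
  ⟨hw.nonneg t ht ξ, (hw.le_bound t ht ξ).trans (G.bound_le_bound_zero ht.1)⟩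

lemma IsHJB.abs_le {β : Control N m} {w : ℝ → State N m → ℝ} (hw : G.IsHJB β w) {t : ℝ}
    (ht : t ∈ Icc 0 G.T) (ξ : State N m) : |w t ξ| ≤ G.bound 0 := by
  rw [abs_of_nonneg (hw.nonneg t ht ξ)]
  exact (hw.mem_Icc ht ξ).2

lemma IsHJB.abs_diff_le {β : Control N m} {w : ℝ → State N m → ℝ} (hw : G.IsHJB β w) {t : ℝ}
    (ht : t ∈ Icc 0 G.T) (ξ : State N m) (i : Fin m) : |diff (w t) ξ i| ≤ G.bound 0 :=
  abs_sub_le_of_nonneg_of_le (hw.mem_Icc ht _).1 (hw.mem_Icc ht _).2 (hw.mem_Icc ht _).1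
    (hw.mem_Icc ht _).2

lemma abs_diff_sub_diff_le {φ ψ : State N m → ℝ} {D : ℝ} (h : ∀ η, |φ η - ψ η| ≤ D)
    (ξ : State N m) (i : Fin m) : |diff φ ξ i - diff ψ ξ i| ≤ 2 * D := by
  have := abs_sub_le_two_mul (φ := φ - ψ) h (ξ.1.succAbove i, ξ.2) ξ
  simp only [Pi.sub_apply] at this
  unfold diff
  convert this using 2
  ring

/-- The minimizers along a solution of the Hamilton-Jacobi-Bellman equation are an admissible
control. -/
lemma IsHJB.admissible_argmin {β : Control N m} (hβ : G.Admissible β) {w : ℝ → State N m → ℝ}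
    (hw : G.IsHJB β w) : G.Admissible fun t ξ => G.argmin ξ (diff (w t) ξ) := by
  refine ⟨?_, fun t _ ξ => G.argmin_mem ξ _⟩
  -- The equation bounds the time derivative of `w`, so `w` is Lipschitz in time, and the minimizer
  -- is Lipschitz in its differences.
  have hbd : ∀ ξ, ∃ C : ℝ, ∀ t ∈ Icc 0 G.T, ‖-G.hjbOperator (β t) (w t) ξ‖ ≤ C := fun ξ =>
    isCompact_Icc.exists_bound_of_continuousOn (G.continuousOn_hjbOperator hβ hw.continuousOn ξ).neg
  choose C hC using hbd
  have hC0 : ∀ ξ, 0 ≤ C ξ := fun ξ =>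
    (norm_nonneg _).trans (hC ξ 0 (left_mem_Icc.2 G.T_pos.le))
  set S := ∑ ξ, C ξ
  have hS0 : 0 ≤ S := Finset.sum_nonneg fun ξ _ => hC0 ξ
  have hlip : ∀ ξ, ∀ s ∈ Icc 0 G.T, ∀ t ∈ Icc 0 G.T, |w s ξ - w t ξ| ≤ S * |s - t| :=
    fun ξ s hs t ht => by
      have := (convex_Icc 0 G.T).norm_image_sub_le_of_norm_hasDerivWithin_le
        (fun u hu => hw.deriv u hu ξ) (fun u hu => (hC ξ u hu).trans
          (Finset.single_le_sum (fun ξ _ => hC0 ξ) (Finset.mem_univ ξ))) ht hs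
      simpa using this
  have hL0 := div_nonneg G.totalRate_nonneg G.modulus_pos.le
  refine ⟨⟨G.totalRate / G.modulus * (2 * S), by positivity⟩, fun ξ =>
    LipschitzOnWith.of_dist_le_mul fun s hs t ht => ?_⟩
  rw [dist_eq_norm, Real.dist_eq]
  refine (G.norm_argmin_sub_le ξ (D := 2 * (S * |s - t|)) (by positivity)
    (abs_diff_sub_diff_le (fun η => hlip η s hs t ht) ξ)).trans (le_of_eq ?_)
  change _ = G.totalRate / G.modulus * (2 * S) * |s - t|
  ring

/-- The loss in the Hamiltonian of an action that is not optimal. -/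
noncomputable def hamGap (G : Game N m) (ξ : State N m) (p : Fin m → ℝ) (a : Act m) : ℝ :=
  G.ham ξ p a - G.ham ξ p (G.argmin ξ p)

lemma hamGap_nonneg (ξ : State N m) (p : Fin m → ℝ) {a : Act m} (ha : a ∈ orthant m) :
    0 ≤ G.hamGap ξ p a := sub_nonneg.2 (G.ham_argmin_le ξ p ha)

/-- The cost functional with the strategies `(α, β)`, compared with the solution of the
Hamilton-Jacobi-Bellman equation for the strategy `β₀` of the other players. -/
theorem IsHJB.J_eq {α β β₀ : Control N m} (hα : G.Admissible α) (hβ : G.Admissible β)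
    (hβ₀ : G.Admissible β₀) {w : ℝ → State N m → ℝ} (hw : G.IsHJB β₀ w) {t : ℝ}
    (ht : t ∈ Icc 0 G.T) (ξ : State N m) :
    G.J t ξ α β = w t ξ + ∫ u in t..G.T, ∑ η, G.transition α β t ξ u η *
      (G.hamGap η (diff (w u) η) (α u η) +
        (G.genOthers (β u) (w u) η - G.genOthers (β₀ u) (w u) η)) := by
  rw [J_eq_add_integral hα hβ hw.terminal_eq hw.deriv
    (fun η => (G.continuousOn_hjbOperator hβ₀ hw.continuousOn η).neg) ht ξ]
  congr 1
  refine intervalIntegral.integral_congr fun u _ => Finset.sum_congr rfl fun η _ => ?_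
  rw [cost_add_genOwn, hamGap, hjbOperator]
  change _ * (_ + -(_ + (G.genOwn 0 (w u) η + G.genOthers (β₀ u) (w u) η))) = _
  ring

lemma IsHJB.J_le {α β β₀ : Control N m} (hα : G.Admissible α) (hβ : G.Admissible β)
    (hβ₀ : G.Admissible β₀) {w : ℝ → State N m → ℝ} (hw : G.IsHJB β₀ w) {t : ℝ}
    (ht : t ∈ Icc 0 G.T) (ξ : State N m) {f : ℝ → ℝ} (hf : ContinuousOn f (Icc t G.T))
    (h : ∀ u ∈ Icc 0 G.T, ∀ η, G.hamGap η (diff (w u) η) (α u η) +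
        (G.genOthers (β u) (w u) η - G.genOthers (β₀ u) (w u) η) ≤ f u) :
    G.J t ξ α β ≤ w t ξ + ∫ u in t..G.T, f u := by
  have hsub : Icc t G.T ⊆ Icc 0 G.T := Icc_subset_Icc_left ht.1
  have hp := isTransition_transition hα hβ ht ξ
  rw [hw.J_eq hα hβ hβ₀ ht ξ]
  have hdiff : ∀ η i, ContinuousOn (fun u => diff (w u) η i) (Icc 0 G.T) := fun η i =>
    (hw.continuousOn _).sub (hw.continuousOn _)
  have hc : ContinuousOn (fun u => ∑ η, G.transition α β t ξ u η *
      (G.hamGap η (diff (w u) η) (α u η) +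
        (G.genOthers (β u) (w u) η - G.genOthers (β₀ u) (w u) η))) (Icc t G.T) :=
    continuousOn_finsetSum _ fun η _ => (hp.continuousOn η).mul
      ((((G.continuousOn_ham_comp η (hα.continuousOn η) (fun s hs => hα.2 s hs η) (hdiff η)).sub
        (G.continuousOn_ham_comp η ((hw.admissible_argmin hβ₀).continuousOn η)
          (fun s _ => G.argmin_mem η _) (hdiff η))).add
        ((hβ.continuousOn_genOthers hw.continuousOn η).sub
          (hβ₀.continuousOn_genOthers hw.continuousOn η))).mono hsub)
  gcongr
  refine intervalIntegral.integral_mono_on ht.2 (hc.intervalIntegrable_of_Icc ht.2)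
    (hf.intervalIntegrable_of_Icc ht.2) fun u hu => ?_
  obtain ⟨hp0, hp1⟩ := (hp.2 u hu).1
  calc _ ≤ ∑ η, G.transition α β t ξ u η * f u := Finset.sum_le_sum fun η _ =>
        mul_le_mul_of_nonneg_left (h u (hsub hu) η) (hp0 η)
    _ = f u := by rw [← Finset.sum_mul, hp1, one_mul]

/-- With the same control of the others the drift terms cancel in `IsHJB.J_eq`, and only the
nonnegative loss is integrated. -/
lemma IsHJB.le_J {α β : Control N m} (hα : G.Admissible α) (hβ : G.Admissible β)
    {w : ℝ → State N m → ℝ} (hw : G.IsHJB β w) {t : ℝ} (ht : t ∈ Icc 0 G.T) (ξ : State N m) :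
    w t ξ ≤ G.J t ξ α β := by
  rw [hw.J_eq hα hβ hβ ht ξ]
  refine le_add_of_nonneg_right (intervalIntegral.integral_nonneg ht.2 fun u hu => ?_)
  refine Finset.sum_nonneg fun η _ => mul_nonneg
    (((isTransition_transition hα hβ ht ξ).2 u hu).1.1 η) ?_
  rw [sub_self, add_zero]
  exact hamGap_nonneg η _ (hα.2 u ⟨ht.1.trans hu.1, hu.2⟩ η)

/-- Verification: bounded solutions of the Hamilton-Jacobi-Bellman equation are value
functions. -/
theorem IsHJB.value_eq {β : Control N m} (hβ : G.Admissible β) {w : ℝ → State N m → ℝ}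
    (hw : G.IsHJB β w) {t : ℝ} (ht : t ∈ Icc 0 G.T) (ξ : State N m) :
    G.value β t ξ = w t ξ := by
  have hopt := hw.admissible_argmin hβ
  refine IsLeast.csInf_eq ⟨⟨_, hopt, le_antisymm (hw.le_J hopt hβ ht ξ) ?_⟩, ?_⟩
  · simpa using hw.J_le hopt hβ hβ ht ξ (f := 0) continuousOn_const
      (fun u _ η => by simp [hamGap])
  · rintro c ⟨α, hα, rfl⟩
    exact hw.le_J hα hβ ht ξ

/-- The value function solves the Hamilton-Jacobi-Bellman equation. -/
theorem isHJB_value {β : Control N m} (hβ : G.Admissible β) : G.IsHJB β (G.value β) := by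
  obtain ⟨w, hw⟩ := G.exists_isHJB hβ
  have e : ∀ t ∈ Icc 0 G.T, G.value β t = w t := fun t ht => funext fun ξ => hw.value_eq hβ ht ξ
  refine ⟨(e _ (right_mem_Icc.2 G.T_pos.le)).trans hw.terminal_eq, fun t ht ξ => ?_,
    fun t ht ξ => e t ht ▸ hw.nonneg t ht ξ, fun t ht ξ => e t ht ▸ hw.le_bound t ht ξ⟩
  rw [e t ht]
  exact (hw.deriv t ht ξ).congr_of_mem (fun s hs => congrFun (e s hs) ξ) ht

lemma admissible_bestResponse {β : Control N m} (hβ : G.Admissible β) :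
    G.Admissible (G.bestResponse β) := (isHJB_value hβ).admissible_argmin hβ

lemma value_le_J {α β : Control N m} (hα : G.Admissible α) (hβ : G.Admissible β)
    {t : ℝ} (ht : t ∈ Icc 0 G.T) (ξ : State N m) : G.value β t ξ ≤ G.J t ξ α β :=
  (isHJB_value hβ).le_J hα hβ ht ξ

/-- The a priori bounds on the value function do not involve `β`, so neither does this one. -/
lemma norm_bestResponse_le {β : Control N m} (hβ : G.Admissible β) {t : ℝ}
    (ht : t ∈ Icc 0 G.T) (ξ : State N m) : ‖G.bestResponse β t ξ‖ ≤ G.actBound (G.bound 0) :=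
  G.norm_argmin_le (G.bound_nonneg G.T_pos.le) ξ ((isHJB_value hβ).abs_diff_le ht ξ)

/-- A control with a uniformly small loss in its own Hamiltonian is an approximate equilibrium. -/
theorem isApproxMPE_of_hamGap_le {β : Control N m} (hβ : G.Admissible β) {δ : ℝ} (hδ : 0 ≤ δ)
    (h : ∀ t ∈ Icc 0 G.T, ∀ ξ, G.hamGap ξ (diff (G.value β t) ξ) (β t ξ) ≤ δ) {ε : ℝ}
    (hε : G.T * δ ≤ ε) : G.IsApproxMPE ε β := by
  refine ⟨hβ, fun t ht ξ γ hγ => ?_⟩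
  have h1 := (isHJB_value hβ).J_le hβ hβ hβ ht ξ (f := fun _ => δ) continuousOn_const
    (fun u hu η => by simpa using h u hu η)
  have h2 := value_le_J hγ hβ ht ξ
  rw [intervalIntegral.integral_const, smul_eq_mul] at h1
  nlinarith [ht.1]

/-! ### Weighted norms and the contraction property -/

/-- The source of the contraction: integration in time gains a factor `1 / K` in the weighted norm.
-/
lemma integral_exp_le {K t T : ℝ} (hK : 0 < K) :
    ∫ u in t..T, Real.exp (K * (T - u)) ≤ Real.exp (K * (T - t)) / K := by
  have hd : ∀ u ∈ uIcc t T, HasDerivAt (fun u => -(Real.exp (K * (T - u)) / K))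
      (Real.exp (K * (T - u))) u := fun u _ => by
    have h := ((((hasDerivAt_id u).const_sub T).const_mul K).exp.div_const K).neg
    refine h.congr_deriv ?_
    simp only [id]
    field_simp
  rw [intervalIntegral.integral_eq_sub_of_hasDerivAt hd
    ((by fun_prop : Continuous fun u => Real.exp (K * (T - u))).intervalIntegrable _ _)]
  have : 0 < Real.exp (K * (T - T)) / K := by positivity
  linarith

/-- Closeness of two functions in an exponentially weighted supremum norm. -/
def Near (G : Game N m) {E : Type*} [NormedAddCommGroup E] (K D : ℝ)
    (φ ψ : ℝ → State N m → E) : Prop :=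
  ∀ t ∈ Icc 0 G.T, ∀ ξ, ‖φ t ξ - ψ t ξ‖ ≤ D * Real.exp (K * (G.T - t))

/-- The value function is Lipschitz in the control of the other players, with a small constant in
a strongly weighted norm. -/
lemma exists_near_value (G : Game N m) : ∃ C : ℝ, 0 ≤ C ∧ ∀ K > 0, ∀ β β' : Control N m,
    G.Admissible β → G.Admissible β' → ∀ D : ℝ, G.Near K D β β' →
      G.Near K (C / K * D) (G.value β) (G.value β') := by
  obtain ⟨C, hC0, hC⟩ := G.exists_abs_genOthers_sub_le
  have hM0 := G.bound_nonneg G.T_pos.le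
  refine ⟨C * G.bound 0, by positivity, fun K hK => ?_⟩
  have key : ∀ β β' : Control N m, G.Admissible β → G.Admissible β' → ∀ D : ℝ, G.Near K D β β' →
      ∀ t ∈ Icc 0 G.T, ∀ ξ, G.value β t ξ - G.value β' t ξ ≤
        C * G.bound 0 / K * D * Real.exp (K * (G.T - t)) := fun β β' hβ hβ' D hD t ht ξ => by
    have hw := isHJB_value hβ'
    -- The best response to `β'` is played against `β`. It has no loss for the value of `β'`, so
    -- only the difference of the drifts of the other players is integrated.
    have h1 := value_le_J (admissible_bestResponse hβ') hβ ht ξ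
    have h2 := hw.J_le (admissible_bestResponse hβ') hβ hβ' ht ξ
      (f := fun u => C * D * G.bound 0 * Real.exp (K * (G.T - u)))
      (by fun_prop) (fun u hu η => by
        have h3 := (abs_le.1 (hC (β u) (β' u) _ (hD u hu) _ _ (hw.abs_le hu) η)).2
        have h4 : G.hamGap η (diff (G.value β' u) η) (G.bestResponse β' u η) = 0 := by
          simp [hamGap, bestResponse]
        rw [h4]
        linarith)
    rw [intervalIntegral.integral_const_mul] at h2
    have hD0 : 0 ≤ D := by
      have := (norm_nonneg _).trans (hD t ht ξ)
      exact nonneg_of_mul_nonneg_left this (Real.exp_pos _)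
    have h5 : C * D * G.bound 0 * ∫ u in t..G.T, Real.exp (K * (G.T - u)) ≤
        C * D * G.bound 0 * (Real.exp (K * (G.T - t)) / K) := by
      gcongr
      exact integral_exp_le hK
    have h6 : C * D * G.bound 0 * (Real.exp (K * (G.T - t)) / K) =
      C * G.bound 0 / K * D * Real.exp (K * (G.T - t)) := by ring
    linarith
  intro β β' hβ hβ' D hD t ht ξ
  refine abs_sub_le_iff.2 ⟨key β β' hβ hβ' D hD t ht ξ,
    key β' β hβ' hβ D (fun u hu η => ?_) t ht ξ⟩
  rw [norm_sub_rev]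
  exact hD u hu η

/-- In a suitable weighted norm the best response is a contraction, and the value function is
nonexpansive. -/
theorem exists_contraction (G : Game N m) : ∃ K : ℝ, 0 < K ∧ ∀ β β' : Control N m,
    G.Admissible β → G.Admissible β' → ∀ D : ℝ, G.Near K D β β' →
      G.Near K (D / 2) (G.bestResponse β) (G.bestResponse β') ∧
        G.Near K D (G.value β) (G.value β') := by
  obtain ⟨C, hC0, hC⟩ := exists_near_value G
  set L := G.totalRate / G.modulus
  have hL : 0 ≤ L := div_nonneg G.totalRate_nonneg G.modulus_pos.le
  -- This `K` ensures `2 * L * C / K ≤ 1 / 2` for the best response and `C / K ≤ 1` for the value.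
  have hK : 0 < 4 * L * C + C + 1 := by positivity
  refine ⟨_, hK, fun β β' hβ hβ' D hD => ?_⟩
  set K := 4 * L * C + C + 1 with hKdef
  have h := hC K hK β β' hβ hβ' D hD
  have hD0 : ∀ ξ : State N m, 0 ≤ D := fun ξ => nonneg_of_mul_nonneg_left
    ((norm_nonneg _).trans (hD 0 (left_mem_Icc.2 G.T_pos.le) ξ)) (Real.exp_pos _)
  refine ⟨fun t ht ξ => ?_, fun t ht ξ => (h t ht ξ).trans ?_⟩
  · have hD' := hD0 ξ
    refine (G.norm_argmin_sub_le ξ (by positivity)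
      (abs_diff_sub_diff_le (fun η => h t ht η) ξ)).trans ?_
    have h1 : L * (2 * (C / K)) ≤ 1 / 2 := by
      rw [← mul_div_assoc, ← mul_div_assoc, div_le_iff₀ hK, hKdef]
      linarith
    calc L * (2 * (C / K * D * Real.exp (K * (G.T - t))))
        = L * (2 * (C / K)) * (D * Real.exp (K * (G.T - t))) := by ring
      _ ≤ 1 / 2 * (D * Real.exp (K * (G.T - t))) := by gcongr
      _ = _ := by ring
  · have hD' := hD0 ξ
    have h1 : C / K ≤ 1 := by
      rw [div_le_one hK, hKdef]
      have : 0 ≤ 4 * L * C := by positivity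
      linarith
    gcongr
    exact mul_le_of_le_one_left hD' h1

/-! ### The supremum norm and admissibility of the iterates -/

lemma sNorm_nonneg {E : Type*} [NormedAddCommGroup E] (ψ : ℝ → State N m → E) :
    0 ≤ G.sNorm ψ := Real.iSup_nonneg fun _ => Real.sqrt_nonneg _

lemma sqrt_sum_sq_le {E : Type*} [NormedAddCommGroup E] {ψ : ℝ → State N m → E} {B : ℝ}
    {t : ℝ} (h : ∀ ξ, ‖ψ t ξ‖ ≤ B) :
    √(∑ ξ, ‖ψ t ξ‖ ^ 2) ≤ √(Fintype.card (State N m) * B ^ 2) := by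
  refine Real.sqrt_le_sqrt ((Finset.sum_le_sum fun ξ _ =>
    pow_le_pow_left₀ (norm_nonneg _) (h ξ) 2).trans (le_of_eq ?_))
  rw [Finset.sum_const, Finset.card_univ, nsmul_eq_mul]

/-- The size of `B` is irrelevant; it is there because an unbounded real supremum takes the default
value `0`. -/
lemma norm_le_sNorm {E : Type*} [NormedAddCommGroup E] {ψ : ℝ → State N m → E} {B : ℝ}
    (h : ∀ t ∈ Icc 0 G.T, ∀ ξ, ‖ψ t ξ‖ ≤ B) {t : ℝ} (ht : t ∈ Icc 0 G.T)
    (ξ : State N m) : ‖ψ t ξ‖ ≤ G.sNorm ψ := by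
  have hbdd : BddAbove (range fun t : Icc 0 G.T => √(∑ ξ, ‖ψ t ξ‖ ^ 2)) :=
    ⟨_, by rintro _ ⟨s, rfl⟩; exact sqrt_sum_sq_le (h s s.2)⟩
  refine le_trans ?_ (le_ciSup hbdd ⟨t, ht⟩)
  refine Real.le_sqrt_of_sq_le ?_
  exact Finset.single_le_sum (f := fun ξ => ‖ψ t ξ‖ ^ 2) (fun _ _ => by positivity)
    (Finset.mem_univ ξ)

lemma sNorm_sq_le {E : Type*} [NormedAddCommGroup E] {ψ : ℝ → State N m → E} {B : ℝ}
    (h : ∀ t ∈ Icc 0 G.T, ∀ ξ, ‖ψ t ξ‖ ≤ B) :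
    G.sNorm ψ ^ 2 ≤ Fintype.card (State N m) * B ^ 2 := by
  rw [← Real.sq_sqrt (by positivity : 0 ≤ Fintype.card (State N m) * B ^ 2)]
  exact pow_le_pow_left₀ (sNorm_nonneg ψ)
    (Real.iSup_le (fun t => sqrt_sum_sq_le (h t t.2)) (Real.sqrt_nonneg _)) 2

lemma Admissible.norm_le_sNorm {α : Control N m} (hα : G.Admissible α) {t : ℝ}
    (ht : t ∈ Icc 0 G.T) (ξ : State N m) : ‖α t ξ‖ ≤ G.sNorm α := by
  obtain ⟨A, -, hA⟩ := hα.exists_norm_le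
  exact Game.norm_le_sNorm hA ht ξ

lemma Admissible.norm_sub_le_sNorm {α β : Control N m} (hα : G.Admissible α)
    (hβ : G.Admissible β) {t : ℝ} (ht : t ∈ Icc 0 G.T) (ξ : State N m) :
    ‖α t ξ - β t ξ‖ ≤ G.sNorm (α - β) := by
  obtain ⟨A, -, hA⟩ := hα.exists_norm_le
  obtain ⟨B, -, hB⟩ := hβ.exists_norm_le
  exact Game.norm_le_sNorm (ψ := α - β)
    (fun s hs η => (norm_sub_le _ _).trans (add_le_add (hA s hs η) (hB s hs η))) ht ξ

lemma abs_value_sub_le_sNorm {α β : Control N m} (hα : G.Admissible α)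
    (hβ : G.Admissible β) {t : ℝ} (ht : t ∈ Icc 0 G.T) (ξ : State N m) :
    |G.value α t ξ - G.value β t ξ| ≤ G.sNorm (G.value α - G.value β) :=
  Game.norm_le_sNorm (ψ := G.value α - G.value β)
    (fun _ hs η => (norm_sub_le _ _).trans (add_le_add ((isHJB_value hα).abs_le hs η)
      ((isHJB_value hβ).abs_le hs η))) ht ξ

lemma Admissible.add {α β : Control N m} (hα : G.Admissible α) (hβ : G.Admissible β) :
    G.Admissible fun t ξ => α t ξ + β t ξ := by
  obtain ⟨⟨K, hK⟩, hα'⟩ := hα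
  obtain ⟨⟨L, hL⟩, hβ'⟩ := hβ
  exact ⟨⟨K + L, fun ξ => (hK ξ).add (hL ξ)⟩,
    fun t ht ξ => add_mem_orthant (hα' t ht ξ) (hβ' t ht ξ)⟩

lemma Admissible.const_smul {α : Control N m} (hα : G.Admissible α) {c : ℝ} (hc : 0 ≤ c) :
    G.Admissible fun t ξ => c • α t ξ := by
  obtain ⟨⟨K, hK⟩, hα'⟩ := hα
  refine ⟨⟨c.toNNReal * K, fun ξ => LipschitzOnWith.of_dist_le_mul fun s hs t ht => ?_⟩,
    fun t ht ξ => smul_mem_orthant hc (hα' t ht ξ)⟩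
  rw [dist_smul₀, Real.norm_of_nonneg hc, NNReal.coe_mul, Real.coe_toNNReal c hc, mul_assoc]
  exact mul_le_mul_of_nonneg_left ((hK ξ).dist_le_mul s hs t ht) hc

lemma admissible_picard {ρ : ℝ} (hρ : ρ ∈ Ico (0 : ℝ) 1) {β₀ : Control N m}
    (hβ₀ : G.Admissible β₀) : ∀ n, G.Admissible (G.picard ρ β₀ n)
  | 0 => hβ₀
  | n + 1 => ((admissible_picard hρ hβ₀ n).const_smul hρ.1).add
      ((admissible_bestResponse (admissible_picard hρ hβ₀ n)).const_smul (sub_nonneg.2 hρ.2.le))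

lemma admissible_corrupted {ρ : ℝ} (hρ : ρ ∈ Ico (0 : ℝ) 1) {β₀ : Control N m}
    (hβ₀ : G.Admissible β₀) {ε : ℕ → Control N m} (hε : ∀ n ≥ 1, G.Admissible (ε n)) :
    ∀ n, G.Admissible (G.corrupted ρ β₀ ε n)
  | 0 => hβ₀
  | n + 1 => ((admissible_corrupted hρ hβ₀ hε n).const_smul hρ.1).add
      (((admissible_bestResponse (admissible_corrupted hρ hβ₀ hε n)).add
        (hε (n + 1) (Nat.le_add_left 1 n))).const_smul (sub_nonneg.2 hρ.2.le))

lemma IsErrorSeq.norm_le {ε : ℕ → Control N m} {e : ℝ} (h : G.IsErrorSeq ε e) {n : ℕ}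
    (hn : 1 ≤ n) {t : ℝ} (ht : t ∈ Icc 0 G.T) (ξ : State N m) : ‖ε n t ξ‖ ≤ e :=
  ((h.1 n hn).norm_le_sNorm ht ξ).trans (h.2.1 ⟨n, hn, rfl⟩)

lemma IsErrorSeq.nonneg {ε : ℕ → Control N m} {e : ℝ} (h : G.IsErrorSeq ε e) : 0 ≤ e :=
  (sNorm_nonneg (ε 1)).trans (h.2.1 ⟨1, mem_Ici.2 le_rfl, rfl⟩)

lemma one_le_weight {K : ℝ} (hK : 0 < K) {t : ℝ} (ht : t ∈ Icc 0 G.T) :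
    1 ≤ Real.exp (K * (G.T - t)) :=
  Real.one_le_exp (mul_nonneg hK.le (sub_nonneg.2 ht.2))

lemma weight_le {K : ℝ} (hK : 0 < K) {t : ℝ} (ht : t ∈ Icc 0 G.T) :
    Real.exp (K * (G.T - t)) ≤ Real.exp (K * G.T) :=
  Real.exp_le_exp.2 (mul_le_mul_of_nonneg_left (by linarith [ht.1]) hK.le)

lemma Near.norm_le {E : Type*} [NormedAddCommGroup E] {K D : ℝ} {φ ψ : ℝ → State N m → E}
    (h : G.Near K D φ ψ) (hK : 0 < K) (hD : 0 ≤ D) {t : ℝ} (ht : t ∈ Icc 0 G.T)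
    (ξ : State N m) : ‖φ t ξ - ψ t ξ‖ ≤ D * Real.exp (K * G.T) :=
  (h t ht ξ).trans (mul_le_mul_of_nonneg_left (weight_le hK ht) hD)

/-! ### Error estimates for the corrupted iteration -/

/-- One step of the averaged iterations. -/
lemma norm_average_sub_le {ρ : ℝ} (hρ : ρ ∈ Ico (0 : ℝ) 1) {a a' b b' e : Act m} {x y z : ℝ}
    (ha : ‖a - a'‖ ≤ x) (hb : ‖b - b'‖ ≤ y) (he : ‖e‖ ≤ z) :
    ‖(ρ • a + (1 - ρ) • (b + e)) - (ρ • a' + (1 - ρ) • b')‖ ≤ ρ * x + (1 - ρ) * (y + z) := by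
  have hρ' : 0 ≤ 1 - ρ := sub_nonneg.2 hρ.2.le
  have h : (ρ • a + (1 - ρ) • (b + e)) - (ρ • a' + (1 - ρ) • b') =
      ρ • (a - a') + (1 - ρ) • ((b - b') + e) := by module
  rw [h]
  refine (norm_add_le _ _).trans (add_le_add ?_ ?_)
  · rw [norm_smul, Real.norm_of_nonneg hρ.1]
    exact mul_le_mul_of_nonneg_left ha hρ.1
  · rw [norm_smul, Real.norm_of_nonneg hρ']
    exact mul_le_mul_of_nonneg_left ((norm_add_le _ _).trans (add_le_add hb he)) hρ'

/-- The errors do not accumulate in the corrupted iteration. -/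
theorem near_corrupted_picard {K : ℝ} (hK : 0 < K)
    (hcontr : ∀ β β' : Control N m, G.Admissible β → G.Admissible β' → ∀ D : ℝ, G.Near K D β β' →
      G.Near K (D / 2) (G.bestResponse β) (G.bestResponse β'))
    {ρ : ℝ} (hρ : ρ ∈ Ico (0 : ℝ) 1) {β₀ : Control N m} (hβ₀ : G.Admissible β₀)
    {ε : ℕ → Control N m} {e : ℝ} (hε : G.IsErrorSeq ε e) (n : ℕ) :
    G.Near K (2 * e) (G.corrupted ρ β₀ ε n) (G.picard ρ β₀ n) := by
  have he := hε.nonneg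
  induction n with
  | zero =>
    intro t _ ξ
    simp only [corrupted, picard, sub_self, norm_zero]
    positivity
  | succ n ih =>
    intro t ht ξ
    have h1 := hcontr _ _ (admissible_corrupted hρ hβ₀ hε.1 n) (admissible_picard hρ hβ₀ n) _ ih
    have h2 : ‖ε (n + 1) t ξ‖ ≤ e * Real.exp (K * (G.T - t)) :=
      (hε.norm_le (Nat.le_add_left 1 n) ht ξ).trans
        (le_mul_of_one_le_right he (one_le_weight hK ht))
    -- The distance `2 * e` is a fixed point of the recursion `x ↦ ρ * x + (1 - ρ) * (x / 2 + e)`,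
    -- whatever `ρ` is.
    refine (norm_average_sub_le hρ (ih t ht ξ) (h1 t ht ξ) h2).trans (le_of_eq ?_)
    ring

/-- The ball of radius `B` is convex and contains every best response plus an error of size at most
one, so averaging never leaves it. -/
lemma norm_corrupted_le {ρ : ℝ} (hρ : ρ ∈ Ico (0 : ℝ) 1) {β₀ : Control N m}
    (hβ₀ : G.Admissible β₀) {ε : ℕ → Control N m} {e : ℝ} (hε : G.IsErrorSeq ε e) (he : e ≤ 1)
    {B : ℝ} (hB : G.sNorm β₀ ≤ B) (hB' : G.actBound (G.bound 0) + 1 ≤ B) (n : ℕ) {t : ℝ}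
    (ht : t ∈ Icc 0 G.T) (ξ : State N m) : ‖G.corrupted ρ β₀ ε n t ξ‖ ≤ B := by
  induction n with
  | zero => exact (hβ₀.norm_le_sNorm ht ξ).trans hB
  | succ n ih =>
    have h := norm_average_sub_le hρ (a := G.corrupted ρ β₀ ε n t ξ) (a' := 0) (x := B)
      (b := G.bestResponse (G.corrupted ρ β₀ ε n) t ξ) (b' := 0) (y := G.actBound (G.bound 0))
      (by rwa [sub_zero])
      (by rw [sub_zero]; exact norm_bestResponse_le (admissible_corrupted hρ hβ₀ hε.1 n) ht ξ)
      (hε.norm_le (Nat.le_add_left 1 n) ht ξ)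
    simp only [smul_zero, add_zero, sub_zero] at h
    refine h.trans ?_
    have h1 : (1 - ρ) * (G.actBound (G.bound 0) + e) ≤ (1 - ρ) * B :=
      mul_le_mul_of_nonneg_left (by linarith) (sub_nonneg.2 hρ.2.le)
    linarith

/-- The increments of the corrupted iteration become as small as the errors. -/
theorem near_corrupted_succ {K : ℝ} (hK : 0 < K)
    (hcontr : ∀ β β' : Control N m, G.Admissible β → G.Admissible β' → ∀ D : ℝ, G.Near K D β β' →
      G.Near K (D / 2) (G.bestResponse β) (G.bestResponse β'))
    {ρ : ℝ} (hρ : ρ ∈ Ico (0 : ℝ) 1) {β₀ : Control N m} (hβ₀ : G.Admissible β₀)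
    {ε : ℕ → Control N m} {e : ℝ} (hε : G.IsErrorSeq ε e) (he : e ≤ 1)
    {B : ℝ} (hB : G.sNorm β₀ ≤ B) (hB' : G.actBound (G.bound 0) + 1 ≤ B) (n : ℕ) :
    G.Near K (((1 + ρ) / 2) ^ n * (2 * B) + 4 * e) (G.corrupted ρ β₀ ε (n + 1))
      (G.corrupted ρ β₀ ε n) := by
  have he0 := hε.nonneg
  have hB0 : 0 ≤ B := (sNorm_nonneg β₀).trans hB
  induction n with
  | zero =>
    intro t ht ξ
    have h := add_le_add (norm_corrupted_le hρ hβ₀ hε he hB hB' 1 ht ξ)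
      (norm_corrupted_le hρ hβ₀ hε he hB hB' 0 ht ξ)
    refine ((norm_sub_le _ _).trans h).trans ?_
    have : 2 * B + 4 * e ≤ (2 * B + 4 * e) * Real.exp (K * (G.T - t)) :=
      le_mul_of_one_le_right (by positivity) (one_le_weight hK ht)
    simp only [pow_zero, one_mul]
    linarith
  | succ n ih =>
    intro t ht ξ
    set W := Real.exp (K * (G.T - t))
    have h1 := hcontr _ _ (admissible_corrupted hρ hβ₀ hε.1 (n + 1))
      (admissible_corrupted hρ hβ₀ hε.1 n) _ ih t ht ξ
    have h2 : ‖ε (n + 2) t ξ - ε (n + 1) t ξ‖ ≤ 2 * e * W := by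
      refine (norm_sub_le _ _).trans ?_
      have := le_mul_of_one_le_right (by positivity : 0 ≤ 2 * e) (one_le_weight hK ht)
      linarith [hε.norm_le (Nat.le_add_left 1 (n + 1)) ht ξ,
        hε.norm_le (Nat.le_add_left 1 n) ht ξ]
    have h3 := norm_average_sub_le hρ (ih t ht ξ) h1 h2
    -- Both errors are attached to the later iterate as a single difference, so that the estimate
    -- for one averaging step applies.
    have e1 : G.corrupted ρ β₀ ε (n + 1 + 1) t ξ - G.corrupted ρ β₀ ε (n + 1) t ξ =
        (ρ • G.corrupted ρ β₀ ε (n + 1) t ξ + (1 - ρ) •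
          (G.bestResponse (G.corrupted ρ β₀ ε (n + 1)) t ξ + (ε (n + 2) t ξ - ε (n + 1) t ξ))) -
        (ρ • G.corrupted ρ β₀ ε n t ξ + (1 - ρ) •
          G.bestResponse (G.corrupted ρ β₀ ε n) t ξ) := by
      rw [show G.corrupted ρ β₀ ε (n + 1 + 1) t ξ = ρ • G.corrupted ρ β₀ ε (n + 1) t ξ +
        (1 - ρ) • (G.bestResponse (G.corrupted ρ β₀ ε (n + 1)) t ξ + ε (n + 2) t ξ) from rfl]
      nth_rw 2 [show G.corrupted ρ β₀ ε (n + 1) t ξ = ρ • G.corrupted ρ β₀ ε n t ξ +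
        (1 - ρ) • (G.bestResponse (G.corrupted ρ β₀ ε n) t ξ + ε (n + 1) t ξ) from rfl]
      module
    rw [e1]
    -- The recursion `x ↦ ρ * x + (1 - ρ) * (x / 2 + 2 * e)` has factor `(1 + ρ) / 2` and fixed
    -- point `4 * e`.
    refine h3.trans (le_of_eq ?_)
    rw [pow_succ]
    ring

/-! ### The loss in the Hamiltonian along the iteration -/

/-- One step of the recursion for the loss in the Hamiltonian. -/
lemma exists_hamGap_average_le (G : Game N m) {B : ℝ} (hB : 0 ≤ B) :
    ∃ C₁ C₂ : ℝ, 0 ≤ C₁ ∧ 0 ≤ C₂ ∧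
    ∀ ρ ∈ Ico (0 : ℝ) 1, ∀ ξ (p q : Fin m → ℝ), (∀ i, |p i| ≤ G.bound 0) →
      (∀ i, |q i| ≤ G.bound 0) → ∀ y ≥ 0, (∀ i, |p i - q i| ≤ y) → ∀ b ∈ orthant m, ‖b‖ ≤ B →
        ∀ h ∈ orthant m, ∀ e ≤ 1, ‖h‖ ≤ e →
          G.hamGap ξ p (ρ • b + (1 - ρ) • (G.argmin ξ q + h)) ≤
            ρ * G.hamGap ξ q b + C₁ * y + C₂ * e := by
  have hM0 := G.bound_nonneg G.T_pos.le
  set M := G.bound 0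
  set A := G.actBound M
  have hA0 : 0 ≤ A := G.actBound_nonneg hM0
  have hΛ := G.totalRate_nonneg
  set Λ := G.totalRate
  obtain ⟨C, hC0, hC⟩ := G.exists_cost_add_le A
  refine ⟨Λ * B + Λ * A + 2 * (Λ * A), C + Λ * M, by positivity, by positivity,
    fun ρ hρ ξ p q hp hq y hy hpq b hb hbB h hh e he1 he => ?_⟩
  have hρ' : 0 ≤ 1 - ρ := sub_nonneg.2 hρ.2.le
  have hqp : ∀ i, |q i - p i| ≤ y := fun i => by rw [abs_sub_comm]; exact hpq i
  have ha := G.argmin_mem ξ q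
  have haA := G.norm_argmin_le hM0 ξ hq
  have hconv := G.ham_convex ξ p (add_mem_orthant ha hh) hb ⟨hρ.1, hρ.2.le⟩
  have h1 : G.ham ξ p b ≤ G.ham ξ q b + Λ * B * y := by
    have := (abs_le.1 (G.abs_ham_sub_ham_le ξ b hpq)).2
    have : Λ * ‖b‖ * y ≤ Λ * B * y := by gcongr
    linarith
  have h2 := G.ham_argmin_sub_le hM0 ξ hp hy hqp
  -- The cost need not be Lipschitz at the boundary of the orthant. Since `h` itself lies in the
  -- orthant, the one-sided estimate suffices.
  have h3 : G.ham ξ p (G.argmin ξ q + h) ≤ G.ham ξ p (G.argmin ξ q) + (C + Λ * M) * e := by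
    have h4 := hC ξ _ ha haA h hh (he.trans he1)
    have h5 := (abs_le.1 (G.abs_sum_mul_rate1_le ξ h p hp)).2
    have h6 : ∑ i, (G.argmin ξ q + h) i * G.rate1 ξ i * p i =
        ∑ i, G.argmin ξ q i * G.rate1 ξ i * p i + ∑ i, h i * G.rate1 ξ i * p i := by
      rw [← Finset.sum_add_distrib]
      exact Finset.sum_congr rfl fun i _ => by simp; ring
    have h7 : (C + Λ * M) * ‖h‖ ≤ (C + Λ * M) * e := by gcongr
    unfold ham
    rw [h6]
    linarith
  have h4 : G.ham ξ p (G.argmin ξ q) ≤ G.ham ξ q (G.argmin ξ q) + Λ * A * y := by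
    have := (abs_le.1 (G.abs_ham_sub_ham_le ξ (G.argmin ξ q) hpq)).2
    have : Λ * ‖G.argmin ξ q‖ * y ≤ Λ * A * y := by gcongr
    linarith
  have he0 : 0 ≤ e := (norm_nonneg h).trans he
  have h5 : ρ * (G.ham ξ p b - G.ham ξ p (G.argmin ξ p)) ≤
      ρ * (G.hamGap ξ q b) + (Λ * B + Λ * A) * y := by
    have h6 : G.ham ξ p b - G.ham ξ p (G.argmin ξ p) ≤
        G.hamGap ξ q b + (Λ * B + Λ * A) * y := by unfold hamGap; linarith
    have h7 : ρ * ((Λ * B + Λ * A) * y) ≤ (Λ * B + Λ * A) * y :=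
      mul_le_of_le_one_left (by positivity) hρ.2.le
    have := mul_le_mul_of_nonneg_left h6 hρ.1
    linarith
  have h6 : (1 - ρ) * (G.ham ξ p (G.argmin ξ q + h) - G.ham ξ p (G.argmin ξ p)) ≤
      2 * (Λ * A) * y + (C + Λ * M) * e := by
    have h7 : G.ham ξ p (G.argmin ξ q + h) - G.ham ξ p (G.argmin ξ p) ≤
      2 * (Λ * A) * y + (C + Λ * M) * e := by linarith
    refine (mul_le_mul_of_nonneg_left h7 hρ').trans
      (mul_le_of_le_one_left (by positivity) (by linarith [hρ.1]))
  have h8 : G.hamGap ξ p (ρ • b + (1 - ρ) • (G.argmin ξ q + h)) ≤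
      ρ * (G.ham ξ p b - G.ham ξ p (G.argmin ξ p)) +
        (1 - ρ) * (G.ham ξ p (G.argmin ξ q + h) - G.ham ξ p (G.argmin ξ p)) := by
    unfold hamGap; linarith
  linarith

/-- Supplies the starting value of the recursion for the loss. -/
lemma exists_hamGap_le (G : Game N m) (B : ℝ) : ∃ C : ℝ, ∀ ξ (p : Fin m → ℝ),
    (∀ i, |p i| ≤ G.bound 0) → ∀ b ∈ orthant m, ‖b‖ ≤ B → G.hamGap ξ p b ≤ C := by
  have hM0 := G.bound_nonneg G.T_pos.le
  have hΛ := G.totalRate_nonneg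
  obtain ⟨C, hC0, hC⟩ := G.exists_cost_le B
  refine ⟨C + G.totalRate * B * G.bound 0 + G.totalRate * G.actBound (G.bound 0) * G.bound 0,
    fun ξ p hp b hb hbB => ?_⟩
  have h1 := hC ξ b hb hbB
  have h2 := (abs_le.1 (G.abs_sum_mul_rate1_le ξ b p hp)).2
  have h3 := (abs_le.1 (G.abs_sum_mul_rate1_le ξ (G.argmin ξ p) p hp)).1
  have h4 := G.cost_nonneg ξ _ (G.argmin_mem ξ p)
  have h5 : G.totalRate * ‖b‖ * G.bound 0 ≤ G.totalRate * B * G.bound 0 := by gcongr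
  have h6 : G.totalRate * ‖G.argmin ξ p‖ * G.bound 0 ≤
      G.totalRate * G.actBound (G.bound 0) * G.bound 0 := by
    gcongr
    exact G.norm_argmin_le hM0 ξ hp
  unfold hamGap ham
  linarith

/-- The loss in the Hamiltonian of the corrupted iterates decreases geometrically to the order of
the errors. -/
theorem exists_hamGap_corrupted_le (G : Game N m) {ρ : ℝ} (hρ : ρ ∈ Ico (0 : ℝ) 1) (R : ℝ) :
    ∃ C Q : ℝ, 0 ≤ C ∧ ∀ β₀, G.Admissible β₀ → G.sNorm β₀ ≤ R → ∀ e ≤ 1, ∀ ε,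
      G.IsErrorSeq ε e → ∀ n, ∀ t ∈ Icc 0 G.T, ∀ ξ,
        G.hamGap ξ (diff (G.value (G.corrupted ρ β₀ ε n) t) ξ) (G.corrupted ρ β₀ ε n t ξ) ≤
          ((1 + ρ) / 2) ^ n * Q + C * e := by
  obtain ⟨K, hK, hcontr⟩ := exists_contraction G
  have hA0 := G.actBound_nonneg (G.bound_nonneg G.T_pos.le)
  -- This radius exceeds both the initial bound and the bound on perturbed best responses; `R` may
  -- be negative.
  set B := max R 0 + (G.actBound (G.bound 0) + 1)
  have hB0 : 0 ≤ B := add_nonneg (le_max_right _ _) (by linarith)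
  have hBA : G.actBound (G.bound 0) + 1 ≤ B := le_add_of_nonneg_left (le_max_right _ _)
  have hBR : R ≤ B := (le_max_left R 0).trans (le_add_of_nonneg_right (by linarith))
  obtain ⟨C₁, C₂, hC₁, hC₂, hstep⟩ := exists_hamGap_average_le G hB0
  obtain ⟨Q₀, hQ₀⟩ := exists_hamGap_le G B
  set W := Real.exp (K * G.T)
  have hW : 0 < W := Real.exp_pos _
  have hρ' : 0 < 1 - ρ := sub_pos.2 hρ.2
  set P := C₁ * (2 * (2 * B * W))
  set S := C₁ * (2 * (4 * W)) + C₂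
  have hS : 0 ≤ S := by positivity
  -- The value increments feed `x * P` into the recursion, with `x = ((1 + ρ) / 2) ^ n`. As `P ≤ Q *
  -- ((1 - ρ) / 2)`, the sum `ρ * x * Q + x * P` is at most `(1 + ρ) / 2 * x * Q`. The part of order
  -- `e` has the fixed point `S / (1 - ρ)` of `s ↦ ρ * s + S`.
  set Q := max Q₀ (P / ((1 - ρ) / 2))
  refine ⟨S / (1 - ρ), Q, by positivity, fun β₀ hβ₀ hR e he ε hε n => ?_⟩
  have he0 := hε.nonneg
  have hadm := admissible_corrupted hρ hβ₀ hε.1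
  have hnorm : ∀ n, ∀ t ∈ Icc 0 G.T, ∀ ξ, ‖G.corrupted ρ β₀ ε n t ξ‖ ≤ B := fun n t ht ξ =>
    norm_corrupted_le hρ hβ₀ hε he (hR.trans hBR) hBA n ht ξ
  induction n with
  | zero =>
    intro t ht ξ
    have h1 := hQ₀ ξ _ ((isHJB_value (hadm 0)).abs_diff_le ht ξ) _ ((hadm 0).2 t ht ξ)
      (hnorm 0 t ht ξ)
    have h2 : Q₀ ≤ Q := le_max_left _ _
    have h3 : 0 ≤ S / (1 - ρ) * e := by positivity
    rw [pow_zero, one_mul]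
    linarith
  | succ n ih =>
    intro t ht ξ
    set x := ((1 + ρ) / 2) ^ n with hx
    have hx0 : 0 ≤ x := by have := hρ.1; positivity
    have hnear := (hcontr _ _ (hadm (n + 1)) (hadm n) _ (near_corrupted_succ hK
      (fun β β' h h' D hD => (hcontr β β' h h' D hD).1) hρ hβ₀ hε he (hR.trans hBR) hBA n)).2
    have h1 := hstep ρ hρ ξ _ _ ((isHJB_value (hadm (n + 1))).abs_diff_le ht ξ)
      ((isHJB_value (hadm n)).abs_diff_le ht ξ) (2 * ((x * (2 * B) + 4 * e) * W))
      (by positivity)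
      (abs_diff_sub_diff_le (fun η => hnear.norm_le hK (by positivity) ht η) ξ)
      _ ((hadm n).2 t ht ξ) (hnorm n t ht ξ) _ ((hε.1 (n + 1) (Nat.le_add_left 1 n)).2 t ht ξ)
      e he (hε.norm_le (Nat.le_add_left 1 n) ht ξ)
    refine h1.trans ?_
    have h2 := mul_le_mul_of_nonneg_left (ih t ht ξ) hρ.1
    have h3 : P ≤ Q * ((1 - ρ) / 2) := by
      rw [← div_le_iff₀ (by positivity)]
      exact le_max_right _ _
    have h4 := mul_le_mul_of_nonneg_left h3 hx0
    have h5 : ρ * (S / (1 - ρ)) + S = S / (1 - ρ) := by field_simp; ring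
    have h6 : C₁ * (2 * ((x * (2 * B) + 4 * e) * W)) + C₂ * e = x * P + S * e := by
      simp only [P, S]; ring
    have h7 : S / (1 - ρ) * e = ρ * (S / (1 - ρ)) * e + S * e := by rw [← add_mul, h5]
    rw [h7, pow_succ, ← hx]
    linarith

/-! ### Stability, error propagation and the conclusion -/

/-- Stability of the equilibrium: admissible controls close to it are approximate equilibria. -/
theorem exists_isStabilityConst (G : Game N m) (hlip : G.CostLocallyLipschitz) :
    ∃ κ : ℝ, 0 < κ ∧ G.IsStabilityConst κ := by
  have hM0 := G.bound_nonneg G.T_pos.le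
  set M := G.bound 0
  set A := G.actBound M
  have hA0 : 0 ≤ A := G.actBound_nonneg hM0
  have hΛ := G.totalRate_nonneg
  set Λ := G.totalRate
  have hT := G.T_pos
  -- The equilibrium is bounded by `A`, and `δ ≤ 1`, so both controls take values in this ball.
  choose C hC using fun ξ => hlip ξ (A + 1)
  set S : ℝ := ∑ ξ, (C ξ : ℝ)
  have hS0 : 0 ≤ S := Finset.sum_nonneg fun ξ _ => (C ξ).2
  have hCS : ∀ ξ, (C ξ : ℝ) ≤ S := fun ξ =>
    Finset.single_le_sum (f := fun ξ => (C ξ : ℝ)) (fun ξ _ => (C ξ).2) (Finset.mem_univ ξ)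
  -- `S` and `Λ * M` account for replacing `γ` by `α` in the cost and in the linear term. The
  -- differences of the values move by at most `2 * δ`, which costs `2 * Λ * A * δ` at the action
  -- `α` and again in the minimum. The final `1` ensures positivity.
  refine ⟨G.T * (S + Λ * M + 4 * (Λ * A)) + 1, by positivity, fun α hα γ hγ δ hδ hclose => ?_⟩
  have hδ0 := hδ.1.le
  refine isApproxMPE_of_hamGap_le hγ (δ := (S + Λ * M + 4 * (Λ * A)) * δ) (by positivity)
    (fun t ht ξ => ?_) (by linarith)
  have h1 : ‖γ t ξ - α t ξ‖ ≤ δ := (hγ.norm_sub_le_sNorm hα.1 ht ξ).trans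
    (by linarith [sNorm_nonneg (G := G) (G.value γ - G.value α)])
  have h2 : ∀ η, |G.value γ t η - G.value α t η| ≤ δ := fun η =>
    (abs_value_sub_le_sNorm hγ hα.1 ht η).trans
      (by linarith [sNorm_nonneg (G := G) (γ - α)])
  set p := diff (G.value γ t) ξ
  set q := diff (G.value α t) ξ
  have hp : ∀ i, |p i| ≤ M := (isHJB_value hγ).abs_diff_le ht ξ
  have hq : ∀ i, |q i| ≤ M := (isHJB_value hα.1).abs_diff_le ht ξ
  have hpq : ∀ i, |p i - q i| ≤ 2 * δ := abs_diff_sub_diff_le h2 ξ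
  have hqp : ∀ i, |q i - p i| ≤ 2 * δ := fun i => by rw [abs_sub_comm]; exact hpq i
  have hαq : α t ξ = G.argmin ξ q := hα.2 t ht ξ
  have hαA : ‖α t ξ‖ ≤ A := hαq ▸ G.norm_argmin_le hM0 ξ hq
  have hγA : ‖γ t ξ‖ ≤ A + 1 := by
    have := norm_sub_norm_le (γ t ξ) (α t ξ)
    linarith [hδ.2]
  have hcost : G.cost ξ (γ t ξ) - G.cost ξ (α t ξ) ≤ S * δ := by
    have := (hC ξ).dist_le_mul (γ t ξ) ⟨hγ.2 t ht ξ, by simpa using hγA⟩ (α t ξ)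
      ⟨hα.1.2 t ht ξ, by simpa using hαA.trans (by linarith)⟩
    rw [Real.dist_eq, dist_eq_norm] at this
    exact (le_abs_self _).trans (this.trans
      (mul_le_mul (hCS ξ) h1 (norm_nonneg _) hS0))
  have hlin : ∑ i, γ t ξ i * G.rate1 ξ i * p i - ∑ i, α t ξ i * G.rate1 ξ i * p i ≤
      Λ * δ * M := by
    have h3 := (abs_le.1 (G.abs_sum_mul_rate1_le ξ (γ t ξ - α t ξ) p hp)).2
    have h4 : Λ * ‖γ t ξ - α t ξ‖ * M ≤ Λ * δ * M := by gcongr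
    refine le_trans (le_of_eq ?_) (h3.trans h4)
    rw [← Finset.sum_sub_distrib]
    exact Finset.sum_congr rfl fun i _ => by simp; ring
  have h3 := (abs_le.1 (G.abs_ham_sub_ham_le ξ (α t ξ) hpq)).2
  have h4 : Λ * ‖α t ξ‖ * (2 * δ) ≤ Λ * A * (2 * δ) := by gcongr
  have h5 := G.ham_argmin_sub_le hM0 ξ hp (by positivity) hqp
  rw [← hαq] at h5
  have h6 : G.ham ξ p (γ t ξ) - G.ham ξ p (α t ξ) ≤ S * δ + Λ * δ * M := by
    unfold ham; linarith
  unfold hamGap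
  linarith

/-- Error propagation in the corrupted iteration. -/
theorem exists_isPropagationConst (G : Game N m) : ∃ c₀ : ℝ, ∀ c ≥ c₀,
    ∀ ρ ∈ Ico (0 : ℝ) 1, ∀ R, G.IsPropagationConst ρ R c := by
  obtain ⟨K, hK, hcontr⟩ := exists_contraction G
  set W := Real.exp (K * G.T)
  have hW : 0 < W := Real.exp_pos _
  -- The factor `2` counts controls and values, the cardinality comes from the sum over states, and
  -- `W` from removing the weight. Neither `ρ` nor `R` enters.
  refine ⟨2 * (Fintype.card (State N m) * (2 * W) ^ 2),
    fun c hc ρ hρ R β₀ hβ₀ _ ε e hε n _ => ?_⟩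
  have he := hε.nonneg
  have hnear := near_corrupted_picard hK (fun β β' h h' D hD => (hcontr β β' h h' D hD).1)
    hρ hβ₀ hε
  have hval := (hcontr _ _ (admissible_corrupted hρ hβ₀ hε.1 (n - 1))
    (admissible_picard hρ hβ₀ (n - 1)) _ (hnear (n - 1))).2
  have h1 := sNorm_sq_le (G := G) (ψ := G.corrupted ρ β₀ ε n - G.picard ρ β₀ n)
    (B := 2 * e * W) fun t ht ξ => (hnear n).norm_le hK (by positivity) ht ξ
  have h2 := sNorm_sq_le (G := G) (ψ := G.value (G.corrupted ρ β₀ ε (n - 1)) -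
      G.value (G.picard ρ β₀ (n - 1)))
    (B := 2 * e * W) fun t ht ξ => hval.norm_le hK (by positivity) ht ξ
  have h3 := mul_le_mul_of_nonneg_right hc (sq_nonneg e)
  refine (add_le_add h1 h2).trans (le_trans (le_of_eq ?_) h3)
  ring

end Game

end SymGame

theorem proposition5p4 {N m : ℕ} (hN : 0 < N) (G : SymGame.Game N m) :
    ∃ κ : ℝ, 0 < κ ∧ (G.CostLocallyLipschitz → G.IsStabilityConst κ) ∧
      ∀ ρ ∈ Set.Ico (0 : ℝ) 1, ∀ R : ℝ, ∃ c : ℝ, 0 < c ∧ G.IsPropagationConst ρ R c ∧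
        ∀ β₀, G.Admissible β₀ → G.sNorm β₀ ≤ R →
          ∀ e : ℝ, 0 < e → e ≤ 1 / (c + 1) →
            ∃ n₀ : ℕ, 1 ≤ n₀ ∧ ∀ ε, G.IsErrorSeq ε e → ∀ n ≥ n₀,
              G.IsApproxMPE (κ * (c + 1) * e) (G.corrupted ρ β₀ ε n) := by
  obtain ⟨κ, hκ, hstab⟩ : ∃ κ : ℝ, 0 < κ ∧ (G.CostLocallyLipschitz → G.IsStabilityConst κ) := by
    -- One `κ` must also serve the last claim, which does not assume a Lipschitz cost; without that
    -- assumption any positive number will do.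
    by_cases h : G.CostLocallyLipschitz
    · obtain ⟨κ, hκ, hs⟩ := SymGame.Game.exists_isStabilityConst G h
      exact ⟨κ, hκ, fun _ => hs⟩
    · exact ⟨1, one_pos, fun h' => absurd h' h⟩
  refine ⟨κ, hκ, hstab, fun ρ hρ R => ?_⟩
  obtain ⟨c₀, hc₀⟩ := SymGame.Game.exists_isPropagationConst G
  obtain ⟨C, Q, hC, hgap⟩ := SymGame.Game.exists_hamGap_corrupted_le G hρ R
  have hT := G.T_pos
  -- Any larger propagation constant is admissible too, so `c` can be chosen with `T * (C + 1) ≤ κ *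
  -- c`, which turns the loss bound into the required precision.
  set c := max c₀ (G.T * (C + 1) / κ) with hc
  have hc1 : G.T * (C + 1) / κ ≤ c := le_max_right _ _
  have hcpos : 0 < c := lt_of_lt_of_le (by positivity) hc1
  refine ⟨c, hcpos, hc₀ c (le_max_left _ _) ρ hρ R, fun β₀ hβ₀ hR e he hec => ?_⟩
  have he1 : e ≤ 1 := hec.trans ((div_le_one (by positivity)).2 (by linarith))
  have hlim : Filter.Tendsto (fun n : ℕ => ((1 + ρ) / 2) ^ n * Q) Filter.atTop (nhds 0) := by
    have := (tendsto_pow_atTop_nhds_zero_of_lt_one (r := (1 + ρ) / 2)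
      (by linarith [hρ.1]) (by linarith [hρ.2])).mul_const Q
    rwa [zero_mul] at this
  -- Beyond `n₀` the transient part of the loss is at most `e`. This index does not depend on the
  -- errors.
  obtain ⟨n₀, hn₀⟩ := Filter.eventually_atTop.1 (hlim.eventually_le_const he)
  refine ⟨max n₀ 1, le_max_right _ _, fun ε hε n hn => ?_⟩
  refine SymGame.Game.isApproxMPE_of_hamGap_le
    (SymGame.Game.admissible_corrupted hρ hβ₀ hε.1 n) (δ := (C + 1) * e) (by positivity)
    (fun t ht ξ => (hgap β₀ hβ₀ hR e he1 ε hε n t ht ξ).trans ?_) ?_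
  · have := hn₀ n ((le_max_left _ _).trans hn)
    linarith
  · rw [div_le_iff₀ hκ] at hc1
    have h1 : G.T * (C + 1) * e ≤ c * κ * e := mul_le_mul_of_nonneg_right hc1 he.le
    have h2 : 0 < κ * e := mul_pos hκ he
    linarith
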